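/- Let $k$ be a field. A finite-dimensional (associative, unital) $k$-algebra $A$ is called elementary if $A/\operatorname{rad}A$ is isomorphic, as a $k$-algebra, to a finite direct product of copies of $k$, where $\operatorname{rad}A$ is the Jacobson radical. Let $A,B,C$ be finite-dimensional elementary $k$-algebras, $A$ of finite global dimension, and let $\{e_1,\dots,e_n\}$, $\{f_1,\dots,f_m\}$ and $\{g_1,\dots,g_p\}$ be complete sets of orthogonal primitive idempotents of $A$, $B$ and $C$ respectively. The field $k$ acts centrally on all bimodules. The trace matrix of an endomorphism $\phi$ of a finite-dimensional $B$-$A$-bimodule $M$ is the matrix $\operatorname{tm}\phi\in k^{n\times m}$ whose $(i,j)$ entry is the trace of the restriction of $\phi$ to $f_jMe_i$; trace matrices for bimodules over the other pairs of algebras are defined in the same way (for an $R$-$S$-bimodule, the rows are indexed by the idempotents of $S$ and the columns by those of $R$). The Cartan matrix of $A$ is the integer matrix $C_A=(\dim_k e_jAe_i)_{1\le i,j\le n}$. Then $C_A$ is invertible over $\mathbb Z$ (that is, $\det C_A=\pm1$), and, with the entries of $C_A^{-1}$ and $C_A^{-T}=(C_A^{-1})^T$ viewed in $k$, the following two statements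 hold. (1) Let $\phi$ be an endomorphism of a finite-dimensional $B$-$A$-bimodule $M$ and $\psi$ an endomorphism of a finite-dimensional $C$-$A$-bimodule $N$. The $C$-$B$-bimodules $\operatorname{Ext}^l_A(M,N)$ ($l\ge0$, extensions of right $A$-modules) are finite-dimensional and vanish for all but finitely many $l$, and $$\sum_{l\ge 0}(-1)^l\,\operatorname{tm}\bigl(\operatorname{Ext}^l_A(\phi,\psi)\bigr)=(\operatorname{tm}\phi)^T\cdot C_A^{-T}\cdot\operatorname{tm}\psi\quad\text{in }k^{m\times p}.$$ (2) Let $\phi$ be an endomorphism of a finite-dimensional $B$-$A$-bimodule $M$ and $\psi$ an endomorphism of a finite-dimensional $A$-$C$-bimodule $N$. The $B$-$C$-bimodules $\operatorname{Tor}^A_l(M,N)$ ($l\ge0$) are finite-dimensional and vanish for all but finitely many $l$, and $$\sum_{l\ge 0}(-1)^l\,\operatorname{tm}\bigl(\operatorname{Tor}_l^A(\phi,\psi)\bigr)=\operatorname{tm}\psi\cdot C_A^{-1}\cdot\operatorname{tm}\phi\quad\text{in }k^{p\times m}.$$ -/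

import Mathlib

open CategoryTheory MulOpposite
open scoped TensorProduct

universe u

namespace LefschetzBimodule

noncomputable section

/-! ### Algebras -/

section Algebras

/-- A `k`-algebra is elementary if its quotient by the Jacobson radical is isomorphic, as a
`k`-algebra, to a finite product of copies of `k`. -/
def IsElementary (k A : Type u) [Field k] [Ring A] [Algebra k A] : Prop :=
  ∃ n : ℕ, Nonempty ((A ⧸ Ring.jacobson A) ≃ₐ[k] (Fin n → k))

/-- A ring has finite (right) global dimension if the projective dimensions of all right modules
are bounded by a common natural number. Right `A`-modules are modules over `Aᵐᵒᵖ`. -/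
def HasFiniteGlobalDimension (A : Type u) [Ring A] : Prop :=
  ∃ d : ℕ, ∀ X : ModuleCat.{u} Aᵐᵒᵖ, HasProjectiveDimensionLE X d

/-- An idempotent is primitive if it is nonzero and is not the sum of two nonzero orthogonal
idempotents. -/
structure IsPrimitiveIdempotent {A : Type u} [Ring A] (x : A) : Prop where
  isIdempotentElem : IsIdempotentElem x
  ne_zero : x ≠ 0
  eq_zero_or_eq_zero : ∀ y z : A, IsIdempotentElem y → IsIdempotentElem z →
    y * z = 0 → z * y = 0 → x = y + z → y = 0 ∨ z = 0

/-- A complete set of orthogonal primitive idempotents: pairwise orthogonal primitive idempotents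
with sum `1`. -/
structure IsCompletePrimitive {A : Type u} [Ring A] {n : ℕ} (e : Fin n → A) : Prop where
  complete : CompleteOrthogonalIdempotents e
  primitive : ∀ i, IsPrimitiveIdempotent (e i)

end Algebras

/-! ### Bimodules

A `B`-`A`-bimodule is a `k`-vector space `M` with commuting actions of `B` and of `Aᵐᵒᵖ`, both
compatible with the action of `k`. The right action `m a` is `op a • m`. -/

section Bimodules

variable (k : Type u) [Field k]
variable {A : Type u} [Ring A] [Algebra k A] {B : Type u} [Ring B] [Algebra k B]

variable (A B) in
/-- Endomorphisms of a `B`-`A`-bimodule `M`. -/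
structure BimoduleEnd (M : Type u) [AddCommGroup M] [Module k M] [Module B M] [Module Aᵐᵒᵖ M]
    extends M →ₗ[k] M where
  map_left : ∀ (b : B) (m : M), toFun (b • m) = b • toFun m
  map_right : ∀ (a : A) (m : M), toFun (op a • m) = op a • toFun m

variable {M : Type u} [AddCommGroup M] [Module k M] [Module B M] [Module Aᵐᵒᵖ M]

/-- A bimodule endomorphism as an endomorphism of the underlying right module. -/
def BimoduleEnd.toRight {k : Type u} [Field k] {A : Type u} [Ring A] [Algebra k A] {B : Type u}
    [Ring B] [Algebra k B] {M : Type u} [AddCommGroup M] [Module k M] [Module B M]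
    [Module Aᵐᵒᵖ M] (φ : BimoduleEnd k A B M) : Module.End Aᵐᵒᵖ M where
  toFun := φ.toFun
  map_add' := φ.map_add'
  map_smul' a m := φ.map_right (unop a) m

/-- A bimodule endomorphism as an endomorphism of the underlying left module. -/
def BimoduleEnd.toLeft {k : Type u} [Field k] {A : Type u} [Ring A] [Algebra k A] {B : Type u}
    [Ring B] [Algebra k B] {M : Type u} [AddCommGroup M] [Module k M] [Module B M]
    [Module Aᵐᵒᵖ M] (φ : BimoduleEnd k A B M) : Module.End B M where
  toFun := φ.toFun
  map_add' := φ.map_add'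
  map_smul' b m := φ.map_left b m

variable [IsScalarTower k B M] [IsScalarTower k Aᵐᵒᵖ M]

variable (M) in
/-- The subspace `b M a` of a `B`-`A`-bimodule `M`. -/
def corner (b : B) (a : A) : Submodule k M :=
  LinearMap.range (Algebra.lsmul k k M b ∘ₗ Algebra.lsmul k k M (op a))

variable {k} in
lemma BimoduleEnd.map_corner (φ : BimoduleEnd k A B M) (b : B) (a : A) :
    ∀ x ∈ corner k M b a, φ.toLinearMap x ∈ corner k M b a := by
  rintro _ ⟨m, rfl⟩
  exact ⟨φ.toFun m, ((φ.map_left b _).trans (congrArg _ (φ.map_right a m))).symm⟩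

variable {n m : ℕ} (e : Fin n → A) (f : Fin m → B)

variable {k} in
/-- The trace matrix of an endomorphism `φ` of a `B`-`A`-bimodule `M`: its `(i, j)` entry is the
trace of the restriction of `φ` to `f_j M e_i`. -/
def traceMatrix (φ : BimoduleEnd k A B M) : Matrix (Fin n) (Fin m) k :=
  Matrix.of fun i j =>
    LinearMap.trace k (corner k M (f j) (e i)) (φ.toLinearMap.restrict (φ.map_corner (f j) (e i)))

variable (M) in
/-- The dimension matrix of a `B`-`A`-bimodule `M`: its `(i, j)` entry is `dim f_j M e_i`. -/
def dimMatrix : Matrix (Fin n) (Fin m) ℤ :=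
  Matrix.of fun i j => (Module.finrank k (corner k M (f j) (e i)) : ℤ)

/-- The Cartan matrix of `A`: its `(i, j)` entry is `dim e_j A e_i`. -/
def cartanMatrix : Matrix (Fin n) (Fin n) ℤ := dimMatrix k A e e

/-- The inverse of the (integer) Cartan matrix, with entries viewed in `k`. -/
def cartanInv : Matrix (Fin n) (Fin n) k := (cartanMatrix k e)⁻¹.map (Int.cast : ℤ → k)

end Bimodules

/-! ### Ext -/

section ExtBimodules

section Functoriality

variable (k : Type u) {A : Type u} [Field k] [Ring A] [Algebra k A]
variable (M N : Type u) [AddCommGroup M] [AddCommGroup N] [Module Aᵐᵒᵖ M] [Module Aᵐᵒᵖ N] (l : ℕ)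

variable (A) in
/-- `Ext^l_A(M, N)` in the category of right `A`-modules. -/
abbrev ExtSpace : Type u := Abelian.Ext.{u} (ModuleCat.of Aᵐᵒᵖ M) (ModuleCat.of Aᵐᵒᵖ N) l

/-- Functoriality of `Ext^l_A(M, N)` in the second variable. -/
def extPost : Module.End Aᵐᵒᵖ N →+* Module.End k (ExtSpace A M N l) where
  toFun g :=
    { toFun := fun x => x.comp (Abelian.Ext.mk₀ (ModuleCat.ofHom g)) (add_zero l)
      map_add' := fun x y => Abelian.Ext.add_comp _ _ _ _
      map_smul' := fun r x => Abelian.Ext.smul_comp _ _ _ _ }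
  map_one' := LinearMap.ext fun x => Abelian.Ext.comp_mk₀_id _
  map_mul' g h := LinearMap.ext fun x => by
    change x.comp (Abelian.Ext.mk₀ (ModuleCat.ofHom h ≫ ModuleCat.ofHom g)) (add_zero l) = _
    rw [← Abelian.Ext.mk₀_comp_mk₀]
    exact (Abelian.Ext.comp_assoc_of_third_deg_zero x _ _ (add_zero l)).symm
  map_zero' := LinearMap.ext fun x => by
    change x.comp (Abelian.Ext.mk₀ 0) (add_zero l) = _
    rw [Abelian.Ext.mk₀_zero, Abelian.Ext.comp_zero]; rfl
  map_add' g h := LinearMap.ext fun x => by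
    change x.comp (Abelian.Ext.mk₀ (ModuleCat.ofHom g + ModuleCat.ofHom h)) (add_zero l) = _
    rw [Abelian.Ext.mk₀_add, Abelian.Ext.comp_add]; rfl

/-- Contravariant functoriality of `Ext^l_A(M, N)` in the first variable. -/
def extPre : (Module.End Aᵐᵒᵖ M)ᵐᵒᵖ →+* Module.End k (ExtSpace A M N l) where
  toFun g :=
    { toFun := fun x => (Abelian.Ext.mk₀ (ModuleCat.ofHom (unop g))).comp x (zero_add l)
      map_add' := fun x y => Abelian.Ext.comp_add _ _ _ _
      map_smul' := fun r x => Abelian.Ext.comp_smul _ _ _ _ }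
  map_one' := LinearMap.ext fun x => Abelian.Ext.mk₀_id_comp _
  map_mul' g h := LinearMap.ext fun x => by
    change (Abelian.Ext.mk₀ (ModuleCat.ofHom (unop g) ≫ ModuleCat.ofHom (unop h))).comp
        x (zero_add l) = _
    exact (Abelian.Ext.mk₀_comp_mk₀_assoc _ _ x).symm
  map_zero' := LinearMap.ext fun x => by
    change (Abelian.Ext.mk₀ 0).comp x (zero_add l) = _
    rw [Abelian.Ext.mk₀_zero, Abelian.Ext.zero_comp]; rfl
  map_add' g h := LinearMap.ext fun x => by
    change (Abelian.Ext.mk₀ (ModuleCat.ofHom (unop g) + ModuleCat.ofHom (unop h))).comp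
        x (zero_add l) = _
    rw [Abelian.Ext.mk₀_add, Abelian.Ext.add_comp]; rfl

lemma extPre_extPost_comm (g : (Module.End Aᵐᵒᵖ M)ᵐᵒᵖ) (h : Module.End Aᵐᵒᵖ N)
    (x : ExtSpace A M N l) :
    extPre k M N l g (extPost k M N l h x) = extPost k M N l h (extPre k M N l g x) :=
  (Abelian.Ext.comp_assoc_of_third_deg_zero _ x _ (zero_add l)).symm

lemma extPost_scalar (r : k) (h : Module.End Aᵐᵒᵖ N)
    (hh : ∀ y, h y = algebraMap k Aᵐᵒᵖ r • y) (x : ExtSpace A M N l) :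
    extPost k M N l h x = r • x := by
  have : ModuleCat.ofHom h = r • 𝟙 (ModuleCat.of Aᵐᵒᵖ N) := by
    ext y
    exact hh y
  change x.comp (Abelian.Ext.mk₀ (ModuleCat.ofHom h)) (add_zero l) = _
  rw [this, Abelian.Ext.mk₀_smul, Abelian.Ext.comp_smul, Abelian.Ext.comp_mk₀_id]

lemma extPre_scalar (r : k) (h : Module.End Aᵐᵒᵖ M)
    (hh : ∀ y, h y = algebraMap k Aᵐᵒᵖ r • y) (x : ExtSpace A M N l) :
    extPre k M N l (op h) x = r • x := by
  have : ModuleCat.ofHom h = r • 𝟙 (ModuleCat.of Aᵐᵒᵖ M) := by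
    ext y
    exact hh y
  change (Abelian.Ext.mk₀ (ModuleCat.ofHom h)).comp x (zero_add l) = _
  rw [this, Abelian.Ext.mk₀_smul, Abelian.Ext.smul_comp, Abelian.Ext.mk₀_id_comp]

end Functoriality

variable (k A B C : Type u) [Field k] [Ring A] [Algebra k A] [Ring B] [Ring C]
variable (M N : Type u) [AddCommGroup M] [AddCommGroup N] [Module Aᵐᵒᵖ M] [Module Aᵐᵒᵖ N] (l : ℕ)

/-- `Ext^l_A(M, N)` for a `B`-`A`-bimodule `M` and a `C`-`A`-bimodule `N`. It is a type synonym of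
`ExtSpace A M N l` that records `k`, `B` and `C`; below it is made a `C`-`B`-bimodule. -/
@[nolint unusedArguments]
def ExtBimodule (_k A _B _C : Type u) [Ring A] (M N : Type u) [AddCommGroup M] [AddCommGroup N]
    [Module Aᵐᵒᵖ M] [Module Aᵐᵒᵖ N] (l : ℕ) : Type u := ExtSpace A M N l

instance : AddCommGroup (ExtBimodule k A B C M N l) :=
  inferInstanceAs (AddCommGroup (ExtSpace A M N l))

instance : Module k (ExtBimodule k A B C M N l) :=
  inferInstanceAs (Module k (ExtSpace A M N l))

section
variable [Module C N] [SMulCommClass C Aᵐᵒᵖ N]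

/-- The left action of `C` on `Ext^l_A(M, N)` induced by its left action on `N`. -/
instance : Module C (ExtBimodule k A B C M N l) :=
  Module.compHom (ExtSpace A M N l) ((extPost k M N l).comp (Module.toModuleEnd Aᵐᵒᵖ N))

instance [Algebra k C] [Module k N] [IsScalarTower k C N] [IsScalarTower k Aᵐᵒᵖ N] :
    IsScalarTower k C (ExtBimodule k A B C M N l) :=
  .of_algebraMap_smul fun r x => extPost_scalar k M N l r _ (fun y => by
    change algebraMap k C r • y = _
    rw [algebraMap_smul, algebraMap_smul]) x

end

section
variable [Module B M] [SMulCommClass B Aᵐᵒᵖ M]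

/-- The right action of `B` on `Ext^l_A(M, N)` induced by its left action on `M`. -/
instance : Module Bᵐᵒᵖ (ExtBimodule k A B C M N l) :=
  Module.compHom (ExtSpace A M N l)
    ((extPre k M N l).comp (RingHom.op (Module.toModuleEnd Aᵐᵒᵖ M)))

instance [Algebra k B] [Module k M] [IsScalarTower k B M] [IsScalarTower k Aᵐᵒᵖ M] :
    IsScalarTower k Bᵐᵒᵖ (ExtBimodule k A B C M N l) :=
  .of_algebraMap_smul fun r x => extPre_scalar k M N l r _ (fun y => by
    change algebraMap k B r • y = _
    rw [algebraMap_smul, algebraMap_smul]) x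

end

instance [Module B M] [SMulCommClass B Aᵐᵒᵖ M] [Module C N] [SMulCommClass C Aᵐᵒᵖ N] :
    SMulCommClass C Bᵐᵒᵖ (ExtBimodule k A B C M N l) where
  smul_comm _ _ x := (extPre_extPost_comm k M N l _ _ x).symm

variable {k A B C M N}
variable [Algebra k B] [Algebra k C] [Module k M] [Module B M] [SMulCommClass B Aᵐᵒᵖ M]
  [Module k N] [Module C N] [SMulCommClass C Aᵐᵒᵖ N]

/-- The endomorphism `Ext^l_A(φ, ψ)` of the `C`-`B`-bimodule `Ext^l_A(M, N)`. -/
def extEnd (φ : BimoduleEnd k A B M) (ψ : BimoduleEnd k A C N) (l : ℕ) :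
    BimoduleEnd k B C (ExtBimodule k A B C M N l) where
  toLinearMap := show Module.End k (ExtSpace A M N l) from
    extPre k M N l (op φ.toRight) ∘ₗ extPost k M N l ψ.toRight
  map_left c x := by
    have h : ψ.toRight * Module.toModuleEnd Aᵐᵒᵖ N c = Module.toModuleEnd Aᵐᵒᵖ N c * ψ.toRight :=
      LinearMap.ext fun y => ψ.map_left c y
    have h' := LinearMap.congr_fun (congrArg (extPost k M N l) h) x
    rw [map_mul, map_mul] at h'
    exact (congrArg (extPre k M N l (op φ.toRight)) h').trans (extPre_extPost_comm k M N l _ _ _)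
  map_right b x := by
    have h : op φ.toRight * op (Module.toModuleEnd Aᵐᵒᵖ M b) =
        op (Module.toModuleEnd Aᵐᵒᵖ M b) * op φ.toRight :=
      congrArg op (LinearMap.ext fun y => (φ.map_left b y).symm)
    have h' := LinearMap.congr_fun (congrArg (extPre k M N l) h) (extPost k M N l ψ.toRight x)
    rw [map_mul, map_mul] at h'
    exact (congrArg (extPre k M N l (op φ.toRight))
      (extPre_extPost_comm k M N l _ _ _).symm).trans h'

end ExtBimodules

/-! ### Tensor products over noncommutative algebras -/

section BalancedTensor

variable (k A : Type u) [Field k] [Ring A] [Algebra k A]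

section
variable (X N : Type u) [AddCommGroup X] [Module k X] [Module Aᵐᵒᵖ X]
  [AddCommGroup N] [Module k N] [Module A N]

/-- The subspace of `X ⊗[k] N` spanned by the elements `x a ⊗ y - x ⊗ a y`. -/
def balancedRelations : Submodule k (X ⊗[k] N) :=
  Submodule.span k {z | ∃ (x : X) (a : A) (y : N), z = (op a • x) ⊗ₜ[k] y - x ⊗ₜ[k] (a • y)}

/-- The tensor product over `A` of a right `A`-module `X` and a left `A`-module `N`. -/
abbrev BalancedTensor : Type u := (X ⊗[k] N) ⧸ balancedRelations k A X N

end

variable {A}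
variable {X X' N N' : Type u}
  [AddCommGroup X] [Module k X] [Module Aᵐᵒᵖ X] [IsScalarTower k Aᵐᵒᵖ X]
  [AddCommGroup X'] [Module k X'] [Module Aᵐᵒᵖ X'] [IsScalarTower k Aᵐᵒᵖ X']
  [AddCommGroup N] [Module k N] [Module A N] [IsScalarTower k A N]
  [AddCommGroup N'] [Module k N'] [Module A N'] [IsScalarTower k A N']

/-- The map `X ⊗_A N → X' ⊗_A N'` induced by `f : X → X'` and `g : N → N'`. -/
def balancedMap (f : X →ₗ[Aᵐᵒᵖ] X') (g : N →ₗ[A] N') :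
    BalancedTensor k A X N →ₗ[k] BalancedTensor k A X' N' :=
  Submodule.mapQ _ _ (TensorProduct.map (f.restrictScalars k) (g.restrictScalars k)) <| by
    refine Submodule.span_le.2 ?_
    rintro _ ⟨x, a, y, rfl⟩
    refine Submodule.subset_span ⟨f x, a, g y, ?_⟩
    simp

@[simp]
lemma balancedMap_mk (f : X →ₗ[Aᵐᵒᵖ] X') (g : N →ₗ[A] N') (x : X) (y : N) :
    balancedMap k f g (Submodule.Quotient.mk (x ⊗ₜ[k] y)) =
      Submodule.Quotient.mk (f x ⊗ₜ[k] g y) := rfl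

end BalancedTensor

lemma balancedTensor_ext {k A X N V : Type u} [Field k] [Ring A] [AddCommGroup X] [Module k X]
    [Module Aᵐᵒᵖ X] [AddCommGroup N] [Module k N] [Module A N] [AddCommGroup V] [Module k V]
    {p q : BalancedTensor k A X N →ₗ[k] V}
    (h : ∀ (x : X) (y : N), p (Submodule.Quotient.mk (x ⊗ₜ[k] y)) =
      q (Submodule.Quotient.mk (x ⊗ₜ[k] y))) : p = q :=
  Submodule.linearMap_qext _ (TensorProduct.ext' h)

/-! ### Tor -/

section DerivedLemmas

variable {C D : Type*} [Category.{u} C] [Category.{u} D] [Abelian C] [HasProjectiveResolutions C]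
  [Abelian D]

instance (F : C ⥤ D) [F.Additive] (n : ℕ) : (F.leftDerived n).Additive where
  map_add {X Y f g} := by
    let P := projectiveResolution X
    let Q := projectiveResolution Y
    have hf := ProjectiveResolution.lift_commutes f P Q
    have hg := ProjectiveResolution.lift_commutes g P Q
    rw [F.leftDerived_map_eq n f _ hf, F.leftDerived_map_eq n g _ hg,
      F.leftDerived_map_eq n (f + g)
        (ProjectiveResolution.lift f P Q + ProjectiveResolution.lift g P Q) (by
          rw [Preadditive.add_comp, hf, hg, Functor.map_add, Preadditive.comp_add]),
      Functor.map_add, Preadditive.add_comp, Preadditive.comp_add]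

lemma leftDerived_app_add {F G : C ⥤ D} [F.Additive] [G.Additive] (α β : F ⟶ G) (n : ℕ) (X : C) :
    (NatTrans.leftDerived (α + β) n).app X =
      (NatTrans.leftDerived α n).app X + (NatTrans.leftDerived β n).app X := by
  let P := projectiveResolution X
  rw [P.leftDerived_app_eq, P.leftDerived_app_eq, P.leftDerived_app_eq,
    ← Preadditive.comp_add, ← Preadditive.add_comp, ← Functor.map_add]
  rfl

lemma leftDerived_app_zero {F G : C ⥤ D} [F.Additive] [G.Additive] (n : ℕ) (X : C) :
    (NatTrans.leftDerived (0 : F ⟶ G) n).app X = 0 := by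
  have h := leftDerived_app_add (0 : F ⟶ G) 0 n X
  rw [add_zero] at h
  exact left_eq_add.1 h

lemma homologyMap_smul {R : Type*} [CommRing R] [Linear R D] {K L : ChainComplex D ℕ} (f : K ⟶ L)
    (r : R) (n : ℕ) :
    HomologicalComplex.homologyMap (r • f) n = r • HomologicalComplex.homologyMap f n :=
  ShortComplex.homologyMap_smul
    ((HomologicalComplex.shortComplexFunctor D (ComplexShape.down ℕ) n).map f) r

lemma leftDerived_app_smul {R : Type*} [CommRing R] [Linear R D] {F G : C ⥤ D} [F.Additive]
    [G.Additive] (α β : F ⟶ G) (r : R) (h : ∀ X, β.app X = r • α.app X) (n : ℕ) (X : C) :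
    (NatTrans.leftDerived β n).app X = r • (NatTrans.leftDerived α n).app X := by
  let P := projectiveResolution X
  have : (NatTrans.mapHomologicalComplex β (ComplexShape.down ℕ)).app P.complex =
      r • (NatTrans.mapHomologicalComplex α (ComplexShape.down ℕ)).app P.complex := by
    ext i
    exact h _
  rw [P.leftDerived_app_eq, P.leftDerived_app_eq, this, ← Linear.comp_smul, ← Linear.smul_comp]
  congr 2
  exact homologyMap_smul _ r n

lemma leftDerived_map_smul {R : Type*} [CommRing R] [Linear R C] [Linear R D] (F : C ⥤ D)
    [F.Additive] [F.Linear R] (r : R) (n : ℕ) (X : C) :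
    (F.leftDerived n).map (r • 𝟙 X) = r • 𝟙 _ := by
  let P := projectiveResolution X
  rw [F.leftDerived_map_eq n (r • 𝟙 X) (P := P) (Q := P) (r • 𝟙 P.complex)]
  · have : (F.mapHomologicalComplex _ ⋙ HomologicalComplex.homologyFunctor _ _ n).map
        (r • 𝟙 P.complex) = r • 𝟙 _ := by
      rw [Functor.comp_map, CategoryTheory.Functor.map_smul, CategoryTheory.Functor.map_id]
      refine (homologyMap_smul _ r n).trans ?_
      rw [HomologicalComplex.homologyMap_id]
      rfl
    rw [this]
    simp
  · rw [Linear.smul_comp, Category.id_comp]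
    ext
    simp only [HomologicalComplex.smul_f_apply, HomologicalComplex.comp_f,
      ChainComplex.single₀_map_f_zero]
    erw [Linear.comp_smul, Category.comp_id]

end DerivedLemmas

section TorBimodules

section Functoriality

variable (k A : Type u) [Field k] [Ring A] [Algebra k A]
variable (M N : Type u) [AddCommGroup M] [AddCommGroup N] [Module Aᵐᵒᵖ M]
  [Module k N] [Module A N] [IsScalarTower k A N] (l : ℕ)

attribute [local instance] ModuleCat.moduleOfAlgebraModule
  ModuleCat.isScalarTower_of_algebra_moduleCat

/-- The functor `- ⊗_A N` from right `A`-modules to `k`-vector spaces. -/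
def tensorFunctor : ModuleCat.{u} Aᵐᵒᵖ ⥤ ModuleCat.{u} k where
  obj X := ModuleCat.of k (BalancedTensor k A X N)
  map f := ModuleCat.ofHom (balancedMap k f.hom LinearMap.id)
  map_id X := by
    ext : 1
    exact balancedTensor_ext fun x y => rfl
  map_comp f g := by
    ext : 1
    exact balancedTensor_ext fun x y => rfl

instance : (tensorFunctor k A N).Additive where
  map_add {X Y f g} := by
    ext : 1
    exact balancedTensor_ext fun x y => by
      change Submodule.Quotient.mk ((f.hom x + g.hom x) ⊗ₜ[k] y) = _
      rw [TensorProduct.add_tmul]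
      rfl

instance : (tensorFunctor k A N).Linear k where
  map_smul _ _ := by
    ext : 1
    exact balancedTensor_ext fun x y => rfl

variable {A N} in
/-- The endomorphism of `- ⊗_A N` induced by an endomorphism of `N`. -/
def tensorNat (g : Module.End A N) : tensorFunctor k A N ⟶ tensorFunctor k A N where
  app X := ModuleCat.ofHom (balancedMap k (LinearMap.id : X →ₗ[Aᵐᵒᵖ] X) g)
  naturality X Y f := by
    ext : 1
    exact balancedTensor_ext fun x y => rfl

/-- `Tor^A_l(M, N)`, the value at `M` of the left derived functor of `- ⊗_A N`. -/
abbrev TorSpace : Type u := ((tensorFunctor k A N).leftDerived l).obj (ModuleCat.of Aᵐᵒᵖ M)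

variable {A}

/-- Functoriality of `Tor^A_l(M, N)` in the first variable. -/
def torLeft : Module.End Aᵐᵒᵖ M →+* Module.End k (TorSpace k A M N l) where
  toFun f := (((tensorFunctor k A N).leftDerived l).map (ModuleCat.ofHom f)).hom
  map_one' := congrArg ModuleCat.Hom.hom (CategoryTheory.Functor.map_id _ _)
  map_mul' f g := congrArg ModuleCat.Hom.hom
    (Functor.map_comp _ (ModuleCat.ofHom g) (ModuleCat.ofHom f))
  map_zero' := congrArg ModuleCat.Hom.hom (Functor.map_zero _ _ _)
  map_add' _ _ := congrArg ModuleCat.Hom.hom (Functor.map_add _)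

/-- Functoriality of `Tor^A_l(M, N)` in the second variable. -/
def torRight : Module.End A N →+* Module.End k (TorSpace k A M N l) where
  toFun g := ((NatTrans.leftDerived (tensorNat k g) l).app (ModuleCat.of Aᵐᵒᵖ M)).hom
  map_one' := by
    have : tensorNat k (1 : Module.End A N) = 𝟙 _ := by
      ext X : 3
      exact balancedTensor_ext fun x y => rfl
    rw [this, NatTrans.leftDerived_id]
    rfl
  map_mul' f g := by
    have : tensorNat k (f * g) = tensorNat k g ≫ tensorNat k f := by
      ext X : 3
      exact balancedTensor_ext fun x y => rfl
    rw [this, NatTrans.leftDerived_comp]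
    rfl
  map_zero' := by
    have : tensorNat k (0 : Module.End A N) = 0 := by
      ext X : 3
      exact balancedTensor_ext fun x y => by
        change Submodule.Quotient.mk (x ⊗ₜ[k] 0) = _
        rw [TensorProduct.tmul_zero]
        rfl
    rw [this, leftDerived_app_zero]
    rfl
  map_add' f g := by
    have : tensorNat k (f + g) = tensorNat k f + tensorNat k g := by
      ext X : 3
      exact balancedTensor_ext fun x y => by
        change Submodule.Quotient.mk (x ⊗ₜ[k] (f y + g y)) = _
        rw [TensorProduct.tmul_add]
        rfl
    rw [this, leftDerived_app_add]
    rfl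

lemma torLeft_torRight_comm (f : Module.End Aᵐᵒᵖ M) (g : Module.End A N) (x : TorSpace k A M N l) :
    torLeft k M N l f (torRight k M N l g x) = torRight k M N l g (torLeft k M N l f x) :=
  (LinearMap.congr_fun (congrArg ModuleCat.Hom.hom
    ((NatTrans.leftDerived (tensorNat k g) l).naturality (ModuleCat.ofHom f))) x).symm

lemma torLeft_scalar (r : k) (f : Module.End Aᵐᵒᵖ M)
    (hf : ∀ y, f y = algebraMap k Aᵐᵒᵖ r • y) (x : TorSpace k A M N l) :
    torLeft k M N l f x = r • x := by
  have : ModuleCat.ofHom f = r • 𝟙 (ModuleCat.of Aᵐᵒᵖ M) := by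
    ext y
    exact hf y
  change (((tensorFunctor k A N).leftDerived l).map (ModuleCat.ofHom f)).hom x = _
  rw [this, leftDerived_map_smul]
  rfl

lemma torRight_scalar (r : k) (g : Module.End A N) (hg : ∀ y, g y = r • y)
    (x : TorSpace k A M N l) : torRight k M N l g x = r • x := by
  change ((NatTrans.leftDerived (tensorNat k g) l).app (ModuleCat.of Aᵐᵒᵖ M)).hom x = _
  rw [leftDerived_app_smul (𝟙 _) (tensorNat k g) r, NatTrans.leftDerived_id]
  · rfl
  · intro X
    ext : 1
    exact balancedTensor_ext fun x y => by
      change Submodule.Quotient.mk (x ⊗ₜ[k] (g y)) = _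
      rw [hg, TensorProduct.tmul_smul]
      rfl

end Functoriality

variable (k A B C : Type u) [Field k] [Ring A] [Algebra k A] [Ring B] [Ring C]
variable (M N : Type u) [AddCommGroup M] [AddCommGroup N] [Module Aᵐᵒᵖ M]
  [Module k N] [Module A N] [IsScalarTower k A N] (l : ℕ)

/-- `Tor^A_l(M, N)` for a `B`-`A`-bimodule `M` and an `A`-`C`-bimodule `N`. It is a type synonym of
`TorSpace k A M N l` that records `B` and `C`; below it is made a `B`-`C`-bimodule. -/
@[nolint unusedArguments]
def TorBimodule (k A _B _C : Type u) [Field k] [Ring A] [Algebra k A] (M N : Type u)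
    [AddCommGroup M] [AddCommGroup N] [Module Aᵐᵒᵖ M] [Module k N] [Module A N]
    [IsScalarTower k A N] (l : ℕ) : Type u := TorSpace k A M N l

instance : AddCommGroup (TorBimodule k A B C M N l) :=
  inferInstanceAs (AddCommGroup (TorSpace k A M N l))

instance : Module k (TorBimodule k A B C M N l) :=
  inferInstanceAs (Module k (TorSpace k A M N l))

section
variable [Module B M] [SMulCommClass B Aᵐᵒᵖ M]

/-- The left action of `B` on `Tor^A_l(M, N)` induced by its left action on `M`. -/
instance : Module B (TorBimodule k A B C M N l) :=
  Module.compHom (TorSpace k A M N l) ((torLeft k M N l).comp (Module.toModuleEnd Aᵐᵒᵖ M))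

instance [Algebra k B] [Module k M] [IsScalarTower k B M] [IsScalarTower k Aᵐᵒᵖ M] :
    IsScalarTower k B (TorBimodule k A B C M N l) :=
  .of_algebraMap_smul fun r x => torLeft_scalar k M N l r _ (fun y => by
    change algebraMap k B r • y = _
    rw [algebraMap_smul, algebraMap_smul]) x

end

section
variable [Module Cᵐᵒᵖ N] [SMulCommClass A Cᵐᵒᵖ N]

/-- The right action of `C` on `N` by left `A`-module endomorphisms. -/
def rightMulEnd : Cᵐᵒᵖ →+* Module.End A N :=
  haveI := SMulCommClass.symm A Cᵐᵒᵖ N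
  Module.toModuleEnd A N

/-- The right action of `C` on `Tor^A_l(M, N)` induced by its right action on `N`. -/
instance : Module Cᵐᵒᵖ (TorBimodule k A B C M N l) :=
  Module.compHom (TorSpace k A M N l) ((torRight k M N l).comp (rightMulEnd A C N))

instance [Algebra k C] [IsScalarTower k Cᵐᵒᵖ N] :
    IsScalarTower k Cᵐᵒᵖ (TorBimodule k A B C M N l) :=
  .of_algebraMap_smul fun r x => torRight_scalar k M N l r (rightMulEnd A C N (algebraMap k Cᵐᵒᵖ r)) (fun y => by
    change algebraMap k Cᵐᵒᵖ r • y = _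
    rw [algebraMap_smul]) x

end

instance [Module B M] [SMulCommClass B Aᵐᵒᵖ M] [Module Cᵐᵒᵖ N] [SMulCommClass A Cᵐᵒᵖ N] :
    SMulCommClass B Cᵐᵒᵖ (TorBimodule k A B C M N l) where
  smul_comm _ _ x := torLeft_torRight_comm k M N l _ _ x

variable {k A B C M N}
variable [Algebra k B] [Algebra k C] [Module k M] [Module B M] [SMulCommClass B Aᵐᵒᵖ M]
  [Module Cᵐᵒᵖ N] [SMulCommClass A Cᵐᵒᵖ N]

/-- The endomorphism `Tor^A_l(φ, ψ)` of the `B`-`C`-bimodule `Tor^A_l(M, N)`. -/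
def torEnd (φ : BimoduleEnd k A B M) (ψ : BimoduleEnd k C A N) (l : ℕ) :
    BimoduleEnd k C B (TorBimodule k A B C M N l) where
  toLinearMap := show Module.End k (TorSpace k A M N l) from
    torLeft k M N l φ.toRight ∘ₗ torRight k M N l ψ.toLeft
  map_left b x := by
    have h : φ.toRight * Module.toModuleEnd Aᵐᵒᵖ M b = Module.toModuleEnd Aᵐᵒᵖ M b * φ.toRight :=
      LinearMap.ext fun y => φ.map_left b y
    have h' := LinearMap.congr_fun (congrArg (torLeft k M N l) h) (torRight k M N l ψ.toLeft x)
    rw [map_mul, map_mul] at h'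
    exact (congrArg (torLeft k M N l φ.toRight) (torLeft_torRight_comm k M N l _ _ _).symm).trans h'
  map_right c x := by
    have h : ψ.toLeft * rightMulEnd A C N (op c) = rightMulEnd A C N (op c) * ψ.toLeft :=
      LinearMap.ext fun y => ψ.map_right c y
    have h' := LinearMap.congr_fun (congrArg (torRight k M N l) h) x
    rw [map_mul, map_mul] at h'
    exact (congrArg (torLeft k M N l φ.toRight) h').trans (torLeft_torRight_comm k M N l _ _ _)

end TorBimodules

end

end LefschetzBimodule

/-! The actions of `B` and `C` can be forgotten. An entry of a trace matrix is the trace of a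
bimodule endomorphism composed with multiplication by idempotents. Idempotents of `B` and `C` act
`A`-linearly, so they can be absorbed into `A`-linear endomorphisms `α` of `M` and `β` of `N`. What
remains is to express the alternating sum of the traces of `Ext^l(α, β)` or `Tor_l(α, β)` through
the traces of `α` on the spaces `M e_i` and of `β` on `N e_j` (respectively `e_j N`):
`trace_ext_eq`, `trace_tor_eq`.

The Hopf trace formula, applied to a bounded resolution of `M` by finite-dimensional projectives,
reduces this to a projective module `P`. There `Hom_A(P, -)` is exact, so the trace of `Hom(α, β)`
is additive in `β`. As `A` is elementary, every nonzero finite-dimensional module contains a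
one-dimensional `S_j` given by a character dual to `e_j`. Hence the trace is the sum over `j` of
`tr(β | N e_j) t_j`, where `t_j = tr Hom(α, S_j)` (`trace_homEnd`). For `N = D(A e_i)`, where
`Hom_A(P, D(A e_i))` is dual to `P ⊗_A A e_i = P e_i`, this reads `tr(α | P e_i) = ∑ C_ij t_j`
(`weightedTrace_eq_sum`), and inverting `C_A` yields `t_j`. Since `P ⊗_A L` is dual to `Hom_A(P,
DL)`, the same formula serves Tor.

The dimension version of the last identity puts the dimension vectors of projectives in the integral
column span of `C_A`. Finite global dimension puts those of the `S_j`, which are the unit vectors,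
there too, so `C_A` is invertible over the integers (`isUnit_det_cartanMatrix`). -/

namespace LefschetzBimodule

/-! ### Traces and exact sequences of vector spaces -/

section LinearAlgebra

variable {k : Type*} [Field k]

/-- The trace is additive in short exact sequences. -/
theorem trace_of_exact {U V W : Type*} [AddCommGroup U] [Module k U] [AddCommGroup V] [Module k V]
    [AddCommGroup W] [Module k W] [Module.Finite k V]
    (i : U →ₗ[k] V) (p : V →ₗ[k] W) (hi : Function.Injective i) (hip : Function.Exact i p)
    (hp : Function.Surjective p) (a : Module.End k U) (b : Module.End k V) (c : Module.End k W)
    (hab : b ∘ₗ i = i ∘ₗ a) (hbc : c ∘ₗ p = p ∘ₗ b) :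
    LinearMap.trace k V b = LinearMap.trace k U a + LinearMap.trace k W c := by
  have : Module.Finite k U := Module.Finite.of_injective i hi
  have : Module.Finite k W := Module.Finite.of_surjective p hp
  obtain ⟨r, hr⟩ := i.exists_leftInverse_of_injective (LinearMap.ker_eq_bot.2 hi)
  obtain ⟨s, hs⟩ := p.exists_rightInverse_of_surjective (LinearMap.range_eq_top.2 hp)
  -- Correcting the section `s` in this way gives `r ∘ₗ s' = 0`, so `i ∘ₗ r` and `s' ∘ₗ p` are
  -- complementary projections.
  let s' : W →ₗ[k] V := s - i ∘ₗ r ∘ₗ s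
  have hpi : p ∘ₗ i = 0 := hip.linearMap_comp_eq_zero
  have hs' : p ∘ₗ s' = LinearMap.id := by
    simp only [s', LinearMap.comp_sub, hs, ← LinearMap.comp_assoc, hpi, LinearMap.zero_comp,
      sub_zero]
  have hid : i ∘ₗ r + s' ∘ₗ p = LinearMap.id := by
    ext v
    obtain ⟨y, hy⟩ := (hip (v - s (p v))).1 (by
      rw [map_sub, ← LinearMap.comp_apply p s, hs, LinearMap.id_apply, sub_self])
    have hv : v = i y + s (p v) := by rw [hy]; abel
    have hry : r (i y) = y := LinearMap.congr_fun hr y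
    have h1 : r v = y + r (s (p v)) := by
      conv_lhs => rw [hv]
      rw [map_add, hry]
    simp only [s', LinearMap.add_apply, LinearMap.comp_apply, LinearMap.sub_apply, h1, map_add,
      LinearMap.id_apply]
    conv_rhs => rw [hv]
    abel
  have hb : b = (b ∘ₗ i) ∘ₗ r + (b ∘ₗ s') ∘ₗ p := by
    rw [LinearMap.comp_assoc, LinearMap.comp_assoc, ← LinearMap.comp_add, hid, LinearMap.comp_id]
  rw [hb, map_add, LinearMap.trace_comp_comm', LinearMap.trace_comp_comm' p (b ∘ₗ s'), hab,
    ← LinearMap.comp_assoc, hr, LinearMap.id_comp, ← LinearMap.comp_assoc, ← hbc,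
    LinearMap.comp_assoc, hs', LinearMap.comp_id]

/-- The trace in a four term exact sequence. -/
theorem trace_of_exact_four {U V W H : Type*} [AddCommGroup U] [Module k U] [AddCommGroup V]
    [Module k V] [AddCommGroup W] [Module k W] [AddCommGroup H] [Module k H] [Module.Finite k V]
    [Module.Finite k W]
    (i : U →ₗ[k] V) (d : V →ₗ[k] W) (p : W →ₗ[k] H) (hi : Function.Injective i)
    (hid : Function.Exact i d) (hdp : Function.Exact d p)
    (hp : Function.Surjective p) (a : Module.End k U) (b : Module.End k V) (c : Module.End k W)
    (h : Module.End k H) (hab : b ∘ₗ i = i ∘ₗ a) (hbc : c ∘ₗ d = d ∘ₗ b) (hch : h ∘ₗ p = p ∘ₗ c) :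
    LinearMap.trace k V b =
      LinearMap.trace k U a + LinearMap.trace k W c - LinearMap.trace k H h := by
  -- The sequence is cut at the image of `d`; the trace of `c` there occurs in both short exact
  -- sequences and is eliminated.
  have hc : ∀ x ∈ LinearMap.range d, c x ∈ LinearMap.range d := by
    rintro _ ⟨x, rfl⟩
    exact ⟨b x, (LinearMap.congr_fun hbc x).symm⟩
  rw [trace_of_exact i d.rangeRestrict hi (fun x => by
      rw [← hid x, Subtype.ext_iff]; rfl) d.surjective_rangeRestrict a b (c.restrict hc) hab
      (by ext x; exact LinearMap.congr_fun hbc x),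
    trace_of_exact (LinearMap.range d).subtype p (Subtype.val_injective)
      (fun x => by rw [hdp x]; simp) hp (c.restrict hc) c h (by ext; rfl) hch]
  abel

/-- The trace of the restriction of an endomorphism to the image of an idempotent. -/
theorem trace_restrict_range_of_isIdempotentElem {V : Type*} [AddCommGroup V] [Module k V]
    [Module.Finite k V] (p : Module.End k V) (hp : IsIdempotentElem p) (f : Module.End k V)
    (hf : ∀ x ∈ LinearMap.range p, f x ∈ LinearMap.range p) :
    LinearMap.trace k _ (f.restrict hf) = LinearMap.trace k V (f ∘ₗ p) := by
  have h1 : f ∘ₗ p = (LinearMap.range p).subtype ∘ₗ (f.restrict hf ∘ₗ p.rangeRestrict) := by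
    ext; rfl
  have h2 : p.rangeRestrict ∘ₗ (LinearMap.range p).subtype = LinearMap.id := by
    ext ⟨_, x, rfl⟩
    exact LinearMap.congr_fun hp x
  rw [h1, LinearMap.trace_comp_comm', LinearMap.comp_assoc, h2, LinearMap.comp_id]

theorem trace_of_isIdempotentElem {V : Type*} [AddCommGroup V] [Module k V]
    [Module.Finite k V] (p : Module.End k V) (hp : IsIdempotentElem p) :
    LinearMap.trace k V p = (Module.finrank k (LinearMap.range p) : k) := by
  have h := trace_restrict_range_of_isIdempotentElem p hp LinearMap.id (fun x hx => hx)
  rw [LinearMap.id_comp] at h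
  rw [← h, show LinearMap.id.restrict _ = (LinearMap.id : Module.End k (LinearMap.range p)) from rfl,
    LinearMap.trace_id]

theorem finrank_of_exact {U V W : Type*} [AddCommGroup U] [Module k U] [AddCommGroup V]
    [Module k V] [AddCommGroup W] [Module k W] [Module.Finite k V]
    (i : U →ₗ[k] V) (p : V →ₗ[k] W) (hi : Function.Injective i) (hip : Function.Exact i p)
    (hp : Function.Surjective p) :
    Module.finrank k V = Module.finrank k U + Module.finrank k W := by
  rw [← p.finrank_range_add_finrank_ker, LinearMap.range_eq_top.2 hp, finrank_top,
    LinearMap.exact_iff.1 hip, LinearMap.finrank_range_of_inj hi, add_comm]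

end LinearAlgebra

/-! ### Telescoping of alternating sums -/

section AlternatingSums

variable {R : Type*} [CommRing R]

/-- Here `v`, `z`, `h` stand for traces on chains, cycles and homology, and `hs` is the trace
identity of `0 → Z_{l+1} → C_{l+1} → Z_l → H_l → 0`. The boundary term disappears as soon as the
complex is zero in degree `D`. -/
theorem alternating_sum_eq_of_chain (v z h : ℕ → R) (h0 : v 0 = z 0)
    (hs : ∀ l, v (l + 1) = z (l + 1) + z l - h l) (D : ℕ) :
    ∑ l ∈ Finset.range (D + 1), (-1) ^ l * v l =
      ∑ l ∈ Finset.range D, (-1) ^ l * h l + (-1) ^ D * z D := by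
  induction D with
  | zero => simp [h0]
  | succ D ih => rw [Finset.sum_range_succ, ih, Finset.sum_range_succ, hs, pow_succ]; ring

/-- Cohomological counterpart, from `0 → Z^l → C^l → Z^{l+1} → H^{l+1} → 0`; in degree `0` there are
no coboundaries, whence `h0`. -/
theorem alternating_sum_eq_of_cochain (v z h : ℕ → R) (h0 : h 0 = z 0)
    (hs : ∀ l, v l = z l + z (l + 1) - h (l + 1)) (D : ℕ) :
    ∑ l ∈ Finset.range D, (-1) ^ l * v l =
      ∑ l ∈ Finset.range (D + 1), (-1) ^ l * h l - (-1) ^ D * z D := by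
  induction D with
  | zero => simp [h0]
  | succ D ih => rw [Finset.sum_range_succ, ih, Finset.sum_range_succ _ (D + 1), hs, pow_succ]; ring

end AlternatingSums

noncomputable section

/-! ### Characters of an elementary algebra dual to its primitive idempotents -/

section Characters

variable {k A : Type u} [Field k] [Ring A] [Algebra k A]

/-- Characters of `A` dual to a family of idempotents, whose common kernel lies in the Jacobson
radical. -/
structure IsDualCharacters {n : ℕ} (e : Fin n → A) (χ : Fin n → A →ₐ[k] k) : Prop where
  apply_eq : ∀ i j, χ i (e j) = if i = j then 1 else 0
  mem_jacobson : ∀ x, (∀ i, χ i x = 0) → x ∈ Ring.jacobson A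

variable (k) in
theorem isNilpotent_jacobson [Module.Finite k A] : IsNilpotent (Ring.jacobson A) := by
  have : IsArtinianRing A := IsArtinianRing.of_finite k A
  exact IsSemiprimaryRing.isNilpotent

theorem isNilpotent_of_mem_jacobson (h : IsNilpotent (Ring.jacobson A)) {x : A}
    (hx : x ∈ Ring.jacobson A) : IsNilpotent x := by
  obtain ⟨s, hs⟩ := h
  exact ⟨s, (Submodule.mem_bot A).1 ((Submodule.zero_eq_bot (R := A) (M := A) ▸ hs) ▸
    Ideal.pow_mem_pow hx s)⟩

theorem IsIdempotentElem.eq_zero_of_isNilpotent {x : A} (hx : IsIdempotentElem x)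
    (h : IsNilpotent x) : x = 0 := by
  obtain ⟨s, hs⟩ := h
  have := hx.pow_succ_eq s
  rw [← this, pow_succ, hs, zero_mul]

/-- The quotient map `π` to `k^r` sends each `e i` to a nonzero 0/1 vector, an idempotent of the
radical being zero. Primitivity and idempotent lifting leave exactly one coordinate `t i` equal to
`1`, and `χ i` is that coordinate of `π`. Since the `e i` sum to `1`, every coordinate is some `t
i`, so the common kernel of the `χ i` is `ker π`. -/
theorem exists_isDualCharacters [Module.Finite k A] (hA : IsElementary k A) {n : ℕ} {e : Fin n → A}
    (he : IsCompletePrimitive e) : ∃ χ : Fin n → A →ₐ[k] k, IsDualCharacters e χ := by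
  classical
  obtain ⟨r, ⟨E⟩⟩ := hA
  let π : A →ₐ[k] (Fin r → k) := E.toAlgHom.comp (Ideal.Quotient.mkₐ k (Ring.jacobson A))
  have hπ : Function.Surjective π := E.surjective.comp (Ideal.Quotient.mkₐ_surjective k _)
  have hker : ∀ x, π x = 0 → x ∈ Ring.jacobson A := fun x hx =>
    Ideal.Quotient.eq_zero_iff_mem.1 (E.injective (hx.trans (map_zero E).symm))
  have hnil : ∀ x ∈ RingHom.ker (π : A →+* (Fin r → k)), IsNilpotent x := fun x hx =>
    isNilpotent_of_mem_jacobson (isNilpotent_jacobson k) (hker x hx)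
  have h01 : ∀ i t, π (e i) t = 0 ∨ π (e i) t = 1 := fun i t => by
    have h := congrFun (congrArg π (he.complete.idem i)) t
    rw [map_mul, Pi.mul_apply] at h
    exact (IsIdempotentElem.iff_eq_zero_or_one (p := π (e i) t)).1 h
  have hex : ∀ i, ∃ t, π (e i) t = 1 := fun i => by
    by_contra! h
    have h0 : π (e i) = 0 := funext fun t => (h01 i t).resolve_right (h t)
    exact (he.primitive i).ne_zero
      ((IsIdempotentElem.eq_zero_of_isNilpotent (he.complete.idem i)) (hnil _ h0))
  have huniq : ∀ i t t', π (e i) t = 1 → π (e i) t' = 1 → t = t' := fun i t t' ht ht' => by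
    by_contra hne
    -- Orthogonality to the image of `1 - e i` allows the unit vector at `t` to be lifted to an
    -- idempotent `y` orthogonal to `1 - e i`, that is, inside `e i * A * e i`. Then `e i = y + (e i
    -- - y)` contradicts primitivity: coordinate `t` shows `y ≠ 0`, coordinate `t'` shows `y ≠ e i`.
    have hz : (Pi.single t 1 : Fin r → k) * (π : A →+* (Fin r → k)) (1 - e i) = 0 := by
      ext s
      by_cases hs : s = t
      · subst hs
        simp [ht]
      · simp [Pi.single_eq_of_ne hs]
    obtain ⟨y, hy, hyt, hy1, hy2⟩ := exists_isIdempotentElem_mul_eq_zero_of_ker_isNilpotent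
      (π : A →+* (Fin r → k)) hnil (Pi.single t 1) (hπ _)
      (by rw [IsIdempotentElem, ← Pi.single_mul, one_mul]) (1 - e i) (he.complete.idem i).one_sub
      hz (by rw [mul_comm, hz])
    have hyt' : π y = Pi.single t 1 := hyt
    have h1 : y * e i = y := by rw [mul_sub, mul_one, sub_eq_zero] at hy1; exact hy1.symm
    have h2 : e i * y = y := by rw [sub_mul, one_mul, sub_eq_zero] at hy2; exact hy2.symm
    have hi : e i * e i = e i := he.complete.idem i
    have hy' : y * y = y := hy
    rcases (he.primitive i).eq_zero_or_eq_zero y (e i - y) hy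
      (by simp only [IsIdempotentElem, sub_mul, mul_sub, h1, h2, hi, hy']; abel)
      (by rw [mul_sub, h1, hy', sub_self]) (by rw [sub_mul, h2, hy', sub_self]) (by abel) with h | h
    · have := congrFun hyt' t
      rw [h] at this
      simp at this
    · rw [sub_eq_zero] at h
      rw [h, hyt', Pi.single_eq_of_ne (Ne.symm hne)] at ht'
      exact zero_ne_one ht'
  choose t ht using hex
  refine ⟨fun i => (Pi.evalAlgHom k (fun _ => k) (t i)).comp π, fun i j => ?_, fun x hx => ?_⟩
  · change π (e j) (t i) = _
    split_ifs with hij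
    · rw [← hij, ht]
    · have h := congrFun (congrArg π (he.complete.ortho hij)) (t i)
      rw [map_mul, map_zero, Pi.mul_apply, ht, one_mul] at h
      exact h
  · refine hker x (funext fun s => ?_)
    have h1 := congrFun (congrArg π he.complete.complete) s
    rw [map_sum, Finset.sum_apply, map_one] at h1
    obtain ⟨i, -, hi⟩ := Finset.exists_ne_zero_of_sum_ne_zero (h1.trans_ne one_ne_zero)
    rw [huniq i s (t i) ((h01 i s).resolve_left hi) (ht i)]
    exact hx i

end Characters

/-! ### One-dimensional modules and eigenvectors -/

section CharacterModules

variable {k A : Type u} [Field k] [Ring A] [Algebra k A]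

/-- The one-dimensional right `A`-module attached to a character of `A`. -/
@[nolint unusedArguments]
def CharacterModule (_χ : A →ₐ[k] k) : Type u := k

variable (χ : A →ₐ[k] k)

instance : AddCommGroup (CharacterModule χ) := inferInstanceAs (AddCommGroup k)
instance : Module k (CharacterModule χ) := inferInstanceAs (Module k k)
instance : Module.Finite k (CharacterModule χ) := inferInstanceAs (Module.Finite k k)
instance : Module Aᵐᵒᵖ (CharacterModule χ) :=
  Module.compHom k (χ.toRingHom.fromOpposite fun _ _ => mul_comm _ _)

theorem CharacterModule.smul_def (a : A) (x : CharacterModule χ) : op a • x = χ a • x := rfl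

instance : IsScalarTower k Aᵐᵒᵖ (CharacterModule χ) :=
  .of_algebraMap_smul fun r x => by
    change op (algebraMap k A r) • x = r • x
    rw [CharacterModule.smul_def, AlgHom.commutes]
    rfl

theorem CharacterModule.finrank_eq : Module.finrank k (CharacterModule χ) = 1 :=
  Module.finrank_self k

variable {χ} {N : Type u} [AddCommGroup N] [Module k N] [Module Aᵐᵒᵖ N] [IsScalarTower k Aᵐᵒᵖ N]

/-- The map from a one-dimensional module given by an eigenvector. -/
def CharacterModule.lift (v : N) (hv : ∀ a : A, op a • v = χ a • v) :
    CharacterModule χ →ₗ[Aᵐᵒᵖ] N where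
  toFun c := (show k from c) • v
  map_add' _ _ := add_smul _ _ _
  map_smul' a c := by
    change (χ (unop a) * (show k from c)) • v = a • (show k from c) • v
    rw [smul_comm a, ← op_unop a, hv, mul_comm, mul_smul, unop_op]

theorem CharacterModule.lift_injective {v : N} (hv : ∀ a : A, op a • v = χ a • v) (h0 : v ≠ 0) :
    Function.Injective (CharacterModule.lift v hv) :=
  smul_left_injective k h0

variable (χ N) in
/-- The submodule of eigenvectors for a character. -/
def eigenSubmodule : Submodule Aᵐᵒᵖ N where
  carrier := {v | ∀ a : A, op a • v = χ a • v}
  add_mem' hv hw a := by rw [smul_add, hv a, hw a, smul_add]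
  zero_mem' a := by rw [smul_zero, smul_zero]
  smul_mem' b v hv a := by
    rw [← op_unop b, hv, smul_comm, hv, smul_comm]

/-- A socle argument: nilpotency of the radical provides a nonzero `v` killed by it, and some `v
e_i` is nonzero because the `e_i` sum to `1`. This `v e_i` is an eigenvector for `χ i`. -/
theorem exists_eigenSubmodule_ne_bot [Module.Finite k A] {n : ℕ} {e : Fin n → A}
    {χ : Fin n → A →ₐ[k] k} (he : CompleteOrthogonalIdempotents e) (hχ : IsDualCharacters e χ)
    [Nontrivial N] : ∃ i, ∃ v ∈ eigenSubmodule (χ i) N, v ≠ 0 := by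
  obtain ⟨s, hs⟩ := isNilpotent_jacobson (A := A) k
  obtain ⟨v, hv0, hv⟩ : ∃ v : N, v ≠ 0 ∧ ∀ x ∈ Ring.jacobson A, op x • v = 0 := by
    by_contra! h
    obtain ⟨y, hy⟩ := exists_ne (0 : N)
    -- If the radical killed no nonzero vector, no power of it would kill `y`.
    have key : ∀ m : ℕ, ∃ x ∈ Ring.jacobson A ^ m, op x • y ≠ 0 := fun m => by
      induction m with
      | zero => exact ⟨1, by rw [Submodule.pow_zero, Ideal.one_eq_top]; trivial, by simpa using hy⟩
      | succ m ih =>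
        obtain ⟨x, hx, hxy⟩ := ih
        obtain ⟨x', hx', hxy'⟩ := h _ hxy
        exact ⟨x * x', Submodule.pow_succ (M := Ring.jacobson A) (n := m) ▸ Submodule.mul_mem_mul hx hx', by
          rwa [op_mul, mul_smul]⟩
    obtain ⟨x, hx, hxy⟩ := key s
    rw [hs] at hx
    rw [(Submodule.mem_bot A).1 hx] at hxy
    simp at hxy
  obtain ⟨i, hi⟩ : ∃ i, op (e i) • v ≠ 0 := by
    by_contra! h
    refine hv0 ?_
    have h1 : op (∑ i, e i) • v = v := by rw [he.complete, op_one, one_smul]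
    rw [← h1, Finset.op_sum, Finset.sum_smul]
    exact Finset.sum_eq_zero fun i _ => h i
  refine ⟨i, op (e i) • v, fun a => ?_, hi⟩
  -- All characters `χ j` vanish on this element, by duality with the idempotents.
  have h1 : e i * a - algebraMap k A (χ i a) * e i ∈ Ring.jacobson A := hχ.mem_jacobson _ fun j => by
    rw [map_sub, map_mul, map_mul, hχ.apply_eq, AlgHom.commutes]
    split_ifs with hji
    · subst hji
      simp
    · simp
  have h2 := hv _ h1
  rw [MulOpposite.op_sub, sub_smul, sub_eq_zero, op_mul, mul_smul, ← Algebra.smul_def, op_smul, smul_assoc] at h2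
  exact h2

end CharacterModules

/-! ### Dévissage of endomorphisms to one-dimensional modules -/

section Induction

variable {k A : Type u} [Field k] [Ring A] [Algebra k A]

/-- Properties of endomorphisms of finite-dimensional right modules that are closed under
extensions and sums and hold for the one-dimensional modules of a dual family of characters. -/
structure EndInductive {n : ℕ} (χ : Fin n → A →ₐ[k] k)
    (Q : ∀ (N : Type u) [AddCommGroup N] [Module k N] [Module Aᵐᵒᵖ N] [IsScalarTower k Aᵐᵒᵖ N]
      [Module.Finite k N], Module.End Aᵐᵒᵖ N → Prop) : Prop where
  of_subsingleton : ∀ (N : Type u) [AddCommGroup N] [Module k N] [Module Aᵐᵒᵖ N]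
    [IsScalarTower k Aᵐᵒᵖ N] [Module.Finite k N] (β : Module.End Aᵐᵒᵖ N), Subsingleton N → Q N β
  character : ∀ i (β : Module.End Aᵐᵒᵖ (CharacterModule (χ i))), Q (CharacterModule (χ i)) β
  add : ∀ (N : Type u) [AddCommGroup N] [Module k N] [Module Aᵐᵒᵖ N]
    [IsScalarTower k Aᵐᵒᵖ N] [Module.Finite k N] (β β' : Module.End Aᵐᵒᵖ N),
    Q N β → Q N β' → Q N (β + β')
  of_exact : ∀ (U N W : Type u) [AddCommGroup U] [Module k U] [Module Aᵐᵒᵖ U]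
    [IsScalarTower k Aᵐᵒᵖ U] [Module.Finite k U] [AddCommGroup N] [Module k N] [Module Aᵐᵒᵖ N]
    [IsScalarTower k Aᵐᵒᵖ N] [Module.Finite k N] [AddCommGroup W] [Module k W] [Module Aᵐᵒᵖ W]
    [IsScalarTower k Aᵐᵒᵖ W] [Module.Finite k W] (i : U →ₗ[Aᵐᵒᵖ] N) (p : N →ₗ[Aᵐᵒᵖ] W)
    (α : Module.End Aᵐᵒᵖ U) (β : Module.End Aᵐᵒᵖ N) (γ : Module.End Aᵐᵒᵖ W),
    Function.Injective i → Function.Exact i p → Function.Surjective p →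
    β ∘ₗ i = i ∘ₗ α → γ ∘ₗ p = p ∘ₗ β → Q U α → Q W γ → Q N β

variable {n : ℕ} {χ : Fin n → A →ₐ[k] k}
  {Q : ∀ (N : Type u) [AddCommGroup N] [Module k N] [Module Aᵐᵒᵖ N] [IsScalarTower k Aᵐᵒᵖ N]
      [Module.Finite k N], Module.End Aᵐᵒᵖ N → Prop}

theorem finrank_quotient_lt {N : Type u} [AddCommGroup N] [Module k N] [Module Aᵐᵒᵖ N]
    [IsScalarTower k Aᵐᵒᵖ N] [Module.Finite k N] (U : Submodule Aᵐᵒᵖ N) (hU : U ≠ ⊥) :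
    Module.finrank k (N ⧸ U) < Module.finrank k N := by
  have h := finrank_of_exact (k := k) (U.subtype.restrictScalars k) (U.mkQ.restrictScalars k)
    Subtype.val_injective (LinearMap.exact_subtype_mkQ U) U.mkQ_surjective
  have : Nontrivial U := Submodule.nontrivial_iff_ne_bot.2 hU
  have h2 : 0 < Module.finrank k U := 
    have : Module.Finite k U := Module.Finite.of_injective (U.subtype.restrictScalars k)
      Subtype.val_injective
    Module.finrank_pos
  change Module.finrank k N = Module.finrank k U + Module.finrank k (N ⧸ U) at h
  omega

theorem EndInductive.of_submodule (hQ : EndInductive χ Q) {N : Type u} [AddCommGroup N]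
    [Module k N] [Module Aᵐᵒᵖ N] [IsScalarTower k Aᵐᵒᵖ N] [Module.Finite k N]
    (β : Module.End Aᵐᵒᵖ N) (U : Submodule Aᵐᵒᵖ N) (hU : ∀ x ∈ U, β x ∈ U)
    [Module.Finite k U] [Module.Finite k (N ⧸ U)]
    (h1 : Q U (β.restrict hU)) (h2 : Q (N ⧸ U) (U.mapQ U β hU)) : Q N β :=
  hQ.of_exact U N (N ⧸ U) U.subtype U.mkQ (β.restrict hU) β (U.mapQ U β hU)
    Subtype.val_injective (LinearMap.exact_subtype_mkQ U) U.mkQ_surjective (by ext; rfl)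
    (by ext; rfl) h1 h2

/-- Every line in an eigenspace is a submodule isomorphic to the character module, and the zero
endomorphism is compatible with it, so induction on the dimension applies. -/
theorem EndInductive.of_eigen_zero (hQ : EndInductive χ Q) (i : Fin n) (d : ℕ) :
    ∀ (N : Type u) [AddCommGroup N]
    [Module k N] [Module Aᵐᵒᵖ N] [IsScalarTower k Aᵐᵒᵖ N] [Module.Finite k N],
    (∀ (a : A) (v : N), op a • v = χ i a • v) → Module.finrank k N ≤ d → Q N 0 := by
  induction d with
  | zero =>
    intro N _ _ _ _ _ _ hd
    exact hQ.of_subsingleton N 0 (Module.finrank_zero_iff.1 (Nat.le_zero.1 hd))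
  | succ d ih =>
    intro N _ _ _ _ _ hN hd
    rcases subsingleton_or_nontrivial N with h | h
    · exact hQ.of_subsingleton N 0 h
    · obtain ⟨v, hv⟩ := exists_ne (0 : N)
      let j := CharacterModule.lift v (fun a => hN a v)
      have hj := CharacterModule.lift_injective (fun a => hN a v) hv
      have hne : LinearMap.range j ≠ ⊥ := fun h0 => hv <| by
        have : j (show k from 1) = 0 :=
          (Submodule.mem_bot Aᵐᵒᵖ).1 (h0 ▸ LinearMap.mem_range_self j _)
        exact (one_smul k v).symm.trans this
      have hlt := finrank_quotient_lt (k := k) (LinearMap.range j) hne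
      have : Module.Finite k (N ⧸ LinearMap.range j) :=
        Module.Finite.of_surjective ((LinearMap.range j).mkQ.restrictScalars k)
          (LinearMap.range j).mkQ_surjective
      refine hQ.of_exact _ N (N ⧸ LinearMap.range j) j (LinearMap.range j).mkQ 0 0 0 hj
        (LinearMap.exact_map_mkQ_range j) (Submodule.mkQ_surjective _) (by simp) (by simp)
        (hQ.character i 0) (ih _ (fun a x => ?_) (by omega))
      obtain ⟨x, rfl⟩ := Submodule.mkQ_surjective _ x
      rw [← map_smul, hN]
      rfl

/-- The rank one endomorphism of an eigenspace given by a vector and a linear form. -/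
def rankOneEnd {N : Type u} [AddCommGroup N] [Module k N] [Module Aᵐᵒᵖ N]
    {χ : A →ₐ[k] k} (hN : ∀ (a : A) (v : N), op a • v = χ a • v)
    (g : Module.Dual k N) (v : N) : Module.End Aᵐᵒᵖ N where
  toFun x := g x • v
  map_add' x y := by rw [map_add, add_smul]
  map_smul' a x := by
    rw [RingHom.id_apply, ← op_unop a, hN, hN, map_smul, smul_assoc]

/-- The line spanned by `v` is stable, the endomorphism acts on it by the scalar `g v`, and it
induces zero on the quotient. -/
theorem EndInductive.rankOneEnd (hQ : EndInductive χ Q) {i : Fin n} {N : Type u}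
    [AddCommGroup N] [Module k N] [Module Aᵐᵒᵖ N] [IsScalarTower k Aᵐᵒᵖ N] [Module.Finite k N]
    (hN : ∀ (a : A) (v : N), op a • v = χ i a • v) (g : Module.Dual k N) (v : N) :
    Q N (rankOneEnd hN g v) := by
  by_cases hv : v = 0
  · have : LefschetzBimodule.rankOneEnd hN g v = 0 := by
      ext x
      change g x • v = 0
      rw [hv, smul_zero]
    rw [this]
    exact hQ.of_eigen_zero i _ N hN le_rfl
  · let j := CharacterModule.lift v (fun a => hN a v)
    have hj := CharacterModule.lift_injective (fun a => hN a v) hv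
    have : Module.Finite k (N ⧸ LinearMap.range j) :=
      Module.Finite.of_surjective ((LinearMap.range j).mkQ.restrictScalars k)
        (LinearMap.range j).mkQ_surjective
    let γ : Module.End Aᵐᵒᵖ (CharacterModule (χ i)) :=
      { toFun := fun c => g v • c
        map_add' := fun x y => smul_add _ _ _
        map_smul' := fun a c => smul_comm _ _ _ }
    refine hQ.of_exact _ N (N ⧸ LinearMap.range j) j (LinearMap.range j).mkQ γ _ 0 hj
      (LinearMap.exact_map_mkQ_range j) (Submodule.mkQ_surjective _) ?_ ?_
      (hQ.character i _) (hQ.of_eigen_zero i _ _ (fun a x => ?_) le_rfl)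
    · ext c
      change g ((show k from c) • v) • v = (g v * (show k from c)) • v
      rw [map_smul, smul_eq_mul, mul_comm]
    · ext x
      change 0 = (LinearMap.range j).mkQ (g x • v)
      exact ((Submodule.Quotient.mk_eq_zero (LinearMap.range j)).2
        (LinearMap.mem_range_self j (show CharacterModule (χ i) from g x))).symm
    · obtain ⟨x, rfl⟩ := Submodule.mkQ_surjective _ x
      rw [← map_smul, hN]
      rfl

/-- An arbitrary `β` may have no eigenvalue in `k`, hence no invariant flag. Writing it as a sum of
rank one endomorphisms avoids this, and is the reason for the clause `add`. -/
theorem EndInductive.of_eigen (hQ : EndInductive χ Q) {i : Fin n} {N : Type u}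
    [AddCommGroup N] [Module k N] [Module Aᵐᵒᵖ N] [IsScalarTower k Aᵐᵒᵖ N] [Module.Finite k N]
    (hN : ∀ (a : A) (v : N), op a • v = χ i a • v) (β : Module.End Aᵐᵒᵖ N) : Q N β := by
  classical
  let b := Module.finBasis k N
  have hβ : β = ∑ l, LefschetzBimodule.rankOneEnd hN (b.coord l) (β (b l)) := by
    have : ∀ x, β (x : N) = ∑ l, (b.coord l) x • β (b l) := fun x => by
      conv_lhs => rw [← b.sum_repr x]
      have := map_sum (β.restrictScalars k) (fun l => b.repr x l • b l) Finset.univ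
      refine this.trans (Finset.sum_congr rfl fun l _ => ?_)
      exact (β.restrictScalars k).map_smul _ _
    ext x
    rw [this, LinearMap.sum_apply]
    rfl
  rw [hβ]
  refine Finset.sum_induction _ (fun γ => Q N γ) (fun γ γ' => hQ.add N γ γ')
    (hQ.of_eigen_zero i _ N hN le_rfl) (fun l _ => hQ.rankOneEnd hN _ _)

/-- An eigensubmodule for a character is stable under every `A`-linear endomorphism, so a nonzero
one can be split off and the dimension of the quotient drops. -/
theorem EndInductive.forall_end [Module.Finite k A] {e : Fin n → A}
    (he : CompleteOrthogonalIdempotents e) (hχ : IsDualCharacters e χ)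
    (hQ : EndInductive χ Q) (d : ℕ) : ∀ (N : Type u) [AddCommGroup N] [Module k N]
    [Module Aᵐᵒᵖ N] [IsScalarTower k Aᵐᵒᵖ N] [Module.Finite k N] (β : Module.End Aᵐᵒᵖ N),
    Module.finrank k N ≤ d → Q N β := by
  induction d with
  | zero =>
    intro N _ _ _ _ _ β hd
    exact hQ.of_subsingleton N β (Module.finrank_zero_iff.1 (Nat.le_zero.1 hd))
  | succ d ih =>
    intro N _ _ _ _ _ β hd
    rcases subsingleton_or_nontrivial N with h | h
    · exact hQ.of_subsingleton N β h
    · obtain ⟨i, v, hv, hv0⟩ := exists_eigenSubmodule_ne_bot (k := k) (N := N) he hχ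
      let U := eigenSubmodule (χ i) N
      have hU : ∀ x ∈ U, β x ∈ U := fun x hx a => by
        rw [← map_smul, hx a]
        exact (β.restrictScalars k).map_smul _ _
      have hlt := finrank_quotient_lt (k := k) U fun h0 =>
        hv0 ((Submodule.mem_bot Aᵐᵒᵖ).1 (h0 ▸ hv))
      have : Module.Finite k (N ⧸ U) :=
        Module.Finite.of_surjective (U.mkQ.restrictScalars k) U.mkQ_surjective
      have : Module.Finite k U := Module.Finite.of_injective (U.subtype.restrictScalars k)
        Subtype.val_injective
      exact hQ.of_submodule β U hU (hQ.of_eigen (i := i) (fun a (x : U) => Subtype.ext (x.2 a)) _)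
        (ih _ _ (by omega))

end Induction

/-! ### Traces weighted by an element of the algebra -/

section WeightedTraces

variable {k A : Type u} [Field k] [Ring A] [Algebra k A]
variable {P N : Type u} [AddCommGroup P] [Module k P] [Module Aᵐᵒᵖ P] [IsScalarTower k Aᵐᵒᵖ P]
  [AddCommGroup N] [Module k N] [Module Aᵐᵒᵖ N] [IsScalarTower k Aᵐᵒᵖ N]

variable (k) in
/-- The action of an element of `A` on a right module. -/
abbrev rightAction (N : Type u) [AddCommGroup N] [Module k N] [Module Aᵐᵒᵖ N]
    [IsScalarTower k Aᵐᵒᵖ N] (a : A) : Module.End k N := Algebra.lsmul k k N (op a)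

variable (k) in
/-- The trace of `y ↦ β (y a)`. -/
def weightedTrace (a : A) (β : Module.End Aᵐᵒᵖ N) : k :=
  LinearMap.trace k N (β.restrictScalars k ∘ₗ rightAction k N a)

theorem weightedTrace_add (a : A) (β β' : Module.End Aᵐᵒᵖ N) :
    weightedTrace k a (β + β') = weightedTrace k a β + weightedTrace k a β' := by
  rw [weightedTrace, weightedTrace, weightedTrace, ← map_add]
  rfl

theorem isIdempotentElem_rightAction {a : A} (ha : IsIdempotentElem a) :
    IsIdempotentElem (rightAction k N a) := by
  rw [IsIdempotentElem, ← map_mul, ← op_mul, ha.eq]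

theorem weightedTrace_of_subsingleton [Subsingleton N] (a : A) (β : Module.End Aᵐᵒᵖ N) :
    weightedTrace k a β = 0 := by
  rw [weightedTrace, Subsingleton.elim (_ ∘ₗ _) (0 : Module.End k N), map_zero]

theorem weightedTrace_of_exact {U W : Type u} [AddCommGroup U] [Module k U] [Module Aᵐᵒᵖ U]
    [IsScalarTower k Aᵐᵒᵖ U] [Module.Finite k N] [AddCommGroup W] [Module k W] [Module Aᵐᵒᵖ W]
    [IsScalarTower k Aᵐᵒᵖ W] (i : U →ₗ[Aᵐᵒᵖ] N) (p : N →ₗ[Aᵐᵒᵖ] W)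
    {α : Module.End Aᵐᵒᵖ U} {β : Module.End Aᵐᵒᵖ N} {γ : Module.End Aᵐᵒᵖ W}
    (hi : Function.Injective i) (hip : Function.Exact i p) (hp : Function.Surjective p)
    (hβ : β ∘ₗ i = i ∘ₗ α) (hγ : γ ∘ₗ p = p ∘ₗ β) (a : A) :
    weightedTrace k a β = weightedTrace k a α + weightedTrace k a γ :=
  trace_of_exact (i.restrictScalars k) (p.restrictScalars k) hi hip hp _ _ _
    (LinearMap.ext fun x => by
      change β (op a • i x) = i (α (op a • x))
      rw [← map_smul]
      exact LinearMap.congr_fun hβ _)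
    (LinearMap.ext fun x => by
      change γ (op a • p x) = p (β (op a • x))
      rw [← map_smul]
      exact LinearMap.congr_fun hγ _)

/-- For an idempotent `a` the functor `N ↦ N a` is exact: elements of `N a` are fixed by `a`, so
multiplying any preimage by `a` gives one in the corner. -/
theorem finrank_range_rightAction_of_exact {U W : Type u} [AddCommGroup U] [Module k U]
    [Module Aᵐᵒᵖ U] [IsScalarTower k Aᵐᵒᵖ U] [Module.Finite k N] [AddCommGroup W] [Module k W]
    [Module Aᵐᵒᵖ W] [IsScalarTower k Aᵐᵒᵖ W] (i : U →ₗ[Aᵐᵒᵖ] N) (p : N →ₗ[Aᵐᵒᵖ] W)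
    (hi : Function.Injective i) (hip : Function.Exact i p) (hp : Function.Surjective p)
    {a : A} (ha : IsIdempotentElem a) :
    Module.finrank k (LinearMap.range (rightAction k N a)) =
      Module.finrank k (LinearMap.range (rightAction k U a)) +
        Module.finrank k (LinearMap.range (rightAction k W a)) := by
  have hfix : ∀ {V : Type u} [AddCommGroup V] [Module k V] [Module Aᵐᵒᵖ V]
      [IsScalarTower k Aᵐᵒᵖ V] {x : V}, x ∈ LinearMap.range (rightAction k V a) → op a • x = x := by
    rintro V _ _ _ _ _ ⟨x, rfl⟩
    exact LinearMap.congr_fun (isIdempotentElem_rightAction (k := k) (N := V) ha) x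
  have hi' : ∀ x ∈ LinearMap.range (rightAction k U a),
      i.restrictScalars k x ∈ LinearMap.range (rightAction k N a) := by
    rintro _ ⟨x, rfl⟩
    exact ⟨i x, (map_smul i _ _).symm⟩
  have hp' : ∀ x ∈ LinearMap.range (rightAction k N a),
      p.restrictScalars k x ∈ LinearMap.range (rightAction k W a) := by
    rintro _ ⟨x, rfl⟩
    exact ⟨p x, (map_smul p _ _).symm⟩
  refine finrank_of_exact ((i.restrictScalars k).restrict hi') ((p.restrictScalars k).restrict hp')
    (fun x y h => Subtype.ext (hi (congrArg Subtype.val h))) (fun x => ?_) ?_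
  · rw [Subtype.ext_iff]
    refine (hip x.1).trans ⟨?_, ?_⟩
    · rintro ⟨y, hy⟩
      refine ⟨⟨op a • y, y, rfl⟩, Subtype.ext ?_⟩
      change i (op a • y) = x
      rw [map_smul, hy, hfix x.2]
    · rintro ⟨y, rfl⟩
      exact ⟨y, rfl⟩
  · rintro ⟨_, z, rfl⟩
    obtain ⟨y, rfl⟩ := hp z
    exact ⟨⟨op a • y, y, rfl⟩, Subtype.ext (map_smul p _ _)⟩

end WeightedTraces

/-! ### Traces on homomorphisms out of a projective module -/

section HomTraces

variable {k A : Type u} [Field k] [Ring A] [Algebra k A]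
variable {P : Type u} [AddCommGroup P] [Module Aᵐᵒᵖ P]
variable {N : Type u} [AddCommGroup N] [Module k N] [Module Aᵐᵒᵖ N] [IsScalarTower k Aᵐᵒᵖ N]

variable (k) in
/-- The endomorphism `f ↦ β f α` of `Hom_A(P, N)`. -/
def homEnd (α : Module.End Aᵐᵒᵖ P) (β : Module.End Aᵐᵒᵖ N) : Module.End k (P →ₗ[Aᵐᵒᵖ] N) where
  toFun f := β ∘ₗ f ∘ₗ α
  map_add' f g := by rw [LinearMap.add_comp, LinearMap.comp_add]
  map_smul' r f := LinearMap.ext fun x => (β.restrictScalars k).map_smul _ _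

instance [Module k P] [IsScalarTower k Aᵐᵒᵖ P] [Module.Finite k P] [Module.Finite k N] : Module.Finite k (P →ₗ[Aᵐᵒᵖ] N) :=
  Module.Finite.of_injective (LinearMap.restrictScalarsₗ k Aᵐᵒᵖ P N k)
    (LinearMap.restrictScalars_injective k)

variable (k P) in
/-- Post-composition with a homomorphism. -/
def homPost {N' : Type u} [AddCommGroup N'] [Module k N'] [Module Aᵐᵒᵖ N'] [IsScalarTower k Aᵐᵒᵖ N']
    (g : N →ₗ[Aᵐᵒᵖ] N') : (P →ₗ[Aᵐᵒᵖ] N) →ₗ[k] (P →ₗ[Aᵐᵒᵖ] N') where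
  toFun f := g ∘ₗ f
  map_add' _ _ := LinearMap.comp_add _ _ _
  map_smul' _ _ := LinearMap.ext fun _ => (g.restrictScalars k).map_smul _ _

variable {U W : Type u} [AddCommGroup U] [Module k U] [Module Aᵐᵒᵖ U]
    [IsScalarTower k Aᵐᵒᵖ U] [AddCommGroup W] [Module k W]
    [Module Aᵐᵒᵖ W] [IsScalarTower k Aᵐᵒᵖ W] (i : U →ₗ[Aᵐᵒᵖ] N) (p : N →ₗ[Aᵐᵒᵖ] W)

theorem homPost_injective (hi : Function.Injective i) : Function.Injective (homPost k P i) :=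
  fun _ _ h => LinearMap.ext fun x => hi (LinearMap.congr_fun h x)

theorem homPost_exact (hi : Function.Injective i) (hip : Function.Exact i p) :
    Function.Exact (homPost k P i) (homPost k P p) := fun f => by
  constructor
  · intro hf
    refine ⟨(LinearEquiv.ofInjective i hi).symm.toLinearMap ∘ₗ f.codRestrict (LinearMap.range i)
      (fun x => (hip _).1 (LinearMap.congr_fun hf x)), LinearMap.ext fun x => ?_⟩
    change i ((LinearEquiv.ofInjective i hi).symm _) = _
    rw [LinearEquiv.ofInjective_symm_apply]
    rfl
  · rintro ⟨f, rfl⟩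
    exact LinearMap.ext fun x => hip.apply_apply_eq_zero _

theorem homPost_surjective [Module.Projective Aᵐᵒᵖ P] (hp : Function.Surjective p) :
    Function.Surjective (homPost k P p) := fun f => Module.projective_lifting_property p f hp

variable {n : ℕ} {e : Fin n → A} {χ : Fin n → A →ₐ[k] k}

theorem rightAction_characterModule (χ : A →ₐ[k] k) (a : A) :
    rightAction k (CharacterModule χ) a = χ a • LinearMap.id := rfl

theorem weightedTrace_characterModule (hχ : IsDualCharacters e χ) (i j : Fin n)
    (β : Module.End Aᵐᵒᵖ (CharacterModule (χ i))) :
    weightedTrace k (e j) β =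
      if i = j then LinearMap.trace k _ (β.restrictScalars k) else 0 := by
  rw [weightedTrace, rightAction_characterModule, LinearMap.comp_smul, LinearMap.comp_id, map_smul, hχ.apply_eq]
  split_ifs <;> simp

theorem finrank_range_rightAction_characterModule (hχ : IsDualCharacters e χ) (i j : Fin n) :
    Module.finrank k (LinearMap.range (rightAction k (CharacterModule (χ i)) (e j))) =
      if i = j then 1 else 0 := by
  rw [rightAction_characterModule, hχ.apply_eq]
  by_cases hij : i = j
  · rw [if_pos hij, if_pos hij, one_smul, LinearMap.range_id, finrank_top,
      CharacterModule.finrank_eq]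
  · rw [if_neg hij, if_neg hij, zero_smul, LinearMap.range_zero, finrank_bot]

/-- Exactness of `Hom_A(P, -)` makes both sides additive in short exact sequences, so only the
one-dimensional modules carry content, and there `β` is a scalar. -/
theorem endInductive_trace_homEnd [Module.Projective Aᵐᵒᵖ P] [Module k P]
    [IsScalarTower k Aᵐᵒᵖ P] [Module.Finite k P]
    (hχ : IsDualCharacters e χ) (α : Module.End Aᵐᵒᵖ P) :
    EndInductive χ fun N _ _ _ _ _ β => LinearMap.trace k _ (homEnd k α β) =
      ∑ j, weightedTrace k (e j) β *
        LinearMap.trace k _ (homEnd k α (LinearMap.id : Module.End Aᵐᵒᵖ (CharacterModule (χ j)))) where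
  of_subsingleton _ _ _ _ _ _ β _ := by
    rw [Subsingleton.elim (homEnd k α β) 0, map_zero]
    simp [weightedTrace_of_subsingleton]
  character i β := by
    obtain ⟨c, hc⟩ : ∃ c : k, β.restrictScalars k = c • LinearMap.id :=
      ⟨(show Module.End k k from β.restrictScalars k) 1,
        (LinearMap.ext_ring (mul_one _).symm : (show Module.End k k from β.restrictScalars k) = _)⟩
    have h : homEnd k α β = c • homEnd k α LinearMap.id := by
      ext f x
      exact LinearMap.congr_fun hc (f (α x))
    simp only [weightedTrace_characterModule hχ, ite_mul, zero_mul, Finset.sum_ite_eq,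
      Finset.mem_univ, if_true]
    rw [h, hc, map_smul, map_smul, LinearMap.trace_id, CharacterModule.finrank_eq, Nat.cast_one,
      smul_eq_mul, smul_eq_mul, mul_one]
  add N _ _ _ _ _ β β' h h' := by
    have : homEnd k α (β + β') = homEnd k α β + homEnd k α β' := by
      ext f x
      rfl
    simp only [this, map_add, h, h', weightedTrace_add, add_mul, Finset.sum_add_distrib]
  of_exact U N W _ _ _ _ _ _ _ _ _ _ _ _ _ _ _ i p a β c hi hip hp hβ hγ h h' := by
    rw [trace_of_exact (homPost k P i) (homPost k P p) (homPost_injective i hi)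
      (homPost_exact i p hi hip) (homPost_surjective p hp) (homEnd k α a) (homEnd k α β)
      (homEnd k α c) (LinearMap.ext fun f => LinearMap.ext fun x => LinearMap.congr_fun hβ _)
      (LinearMap.ext fun f => LinearMap.ext fun x => LinearMap.congr_fun hγ _), h, h',
      ← Finset.sum_add_distrib]
    exact Finset.sum_congr rfl fun j _ => by
      rw [weightedTrace_of_exact i p hi hip hp hβ hγ, add_mul]

/-- The same argument for dimensions, as an identity of natural numbers: traces see dimensions only
modulo the characteristic, while the determinant of the Cartan matrix needs integers. The
endomorphism plays no role. -/
theorem endInductive_finrank_hom [Module.Projective Aᵐᵒᵖ P] [Module k P]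
    [IsScalarTower k Aᵐᵒᵖ P] [Module.Finite k P]
    (he : CompleteOrthogonalIdempotents e) (hχ : IsDualCharacters e χ) :
    EndInductive χ fun N _ _ _ _ _ _ => Module.finrank k (P →ₗ[Aᵐᵒᵖ] N) =
      ∑ j, Module.finrank k (LinearMap.range (rightAction k N (e j))) *
        Module.finrank k (P →ₗ[Aᵐᵒᵖ] CharacterModule (χ j)) where
  of_subsingleton N _ _ _ _ _ β _ := by
    rw [Module.finrank_zero_of_subsingleton]
    exact (Finset.sum_eq_zero fun j _ => by
      rw [Module.finrank_zero_of_subsingleton, zero_mul]).symm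
  character i _ := by
    simp [finrank_range_rightAction_characterModule hχ]
  add N _ _ _ _ _ β β' h _ := h
  of_exact U N W _ _ _ _ _ _ _ _ _ _ _ _ _ _ _ i p a β c hi hip hp hβ hγ h h' := by
    rw [finrank_of_exact (homPost k P i) (homPost k P p) (homPost_injective i hi)
      (homPost_exact i p hi hip) (homPost_surjective p hp), h, h',
      ← Finset.sum_add_distrib]
    exact Finset.sum_congr rfl fun j _ => by
      rw [finrank_range_rightAction_of_exact i p hi hip hp (he.idem j), add_mul]

end HomTraces

/-! ### Duality between tensor products and homomorphisms -/

section Duality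

variable {k A : Type u} [Field k] [Ring A] [Algebra k A]

/-- The dual of a left `A`-module, as a right `A`-module. -/
def DualModule (k A L : Type u) [Field k] [Ring A] [AddCommGroup L] [Module k L] [Module A L] :
    Type u := Module.Dual k L

variable (L : Type u) [AddCommGroup L] [Module k L] [Module A L]

instance : AddCommGroup (DualModule k A L) := inferInstanceAs (AddCommGroup (Module.Dual k L))
instance : Module k (DualModule k A L) := inferInstanceAs (Module k (Module.Dual k L))
instance [Module.Finite k L] : Module.Finite k (DualModule k A L) :=
  inferInstanceAs (Module.Finite k (Module.Dual k L))

variable [IsScalarTower k A L]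

instance : Module Aᵐᵒᵖ (DualModule k A L) where
  smul a g := (show Module.Dual k L from g) ∘ₗ Algebra.lsmul k k L (unop a)
  one_smul g := LinearMap.ext fun x => congrArg (show Module.Dual k L from g) (one_smul A x)
  mul_smul a b g := LinearMap.ext fun x =>
    congrArg (show Module.Dual k L from g) (mul_smul (unop b) (unop a) x)
  smul_zero _ := LinearMap.zero_comp _
  smul_add _ _ _ := LinearMap.add_comp _ _ _
  add_smul a b g := LinearMap.ext fun x =>
    (congrArg (show Module.Dual k L from g) (add_smul (unop a) (unop b) x)).trans (map_add _ _ _)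
  zero_smul g := LinearMap.ext fun x =>
    (congrArg (show Module.Dual k L from g) (zero_smul A x)).trans (map_zero _)

instance : IsScalarTower k Aᵐᵒᵖ (DualModule k A L) :=
  .of_algebraMap_smul fun r g => LinearMap.ext fun x =>
    (congrArg (show Module.Dual k L from g) (algebraMap_smul A r x)).trans (map_smul _ _ _)

variable {L}

/-- The transpose of an endomorphism of a left module. -/
def dualEnd (β : Module.End A L) : Module.End Aᵐᵒᵖ (DualModule k A L) where
  toFun g := (show Module.Dual k L from g) ∘ₗ β.restrictScalars k
  map_add' _ _ := LinearMap.add_comp _ _ _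
  map_smul' a g := LinearMap.ext fun x =>
    congrArg (show Module.Dual k L from g) (map_smul β (unop a) x).symm

/-- The endomorphism on the left is the transpose of the one on the right, and transposition
preserves traces. -/
theorem weightedTrace_dualEnd [Module.Finite k L] (a : A) (β : Module.End A L) :
    weightedTrace k a (dualEnd (k := k) β) =
      LinearMap.trace k L (Algebra.lsmul k k L a ∘ₗ β.restrictScalars k) :=
  LinearMap.congr_fun (LinearMap.trace_transpose (R := k) (M := L))
    (Algebra.lsmul k k L a ∘ₗ β.restrictScalars k)

theorem finrank_range_rightAction_dualModule [Module.Finite k L] (a : A) :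
    Module.finrank k (LinearMap.range (rightAction k (DualModule k A L) a)) =
      Module.finrank k (LinearMap.range (Algebra.lsmul k k L a : Module.End k L)) :=
  LinearMap.finrank_range_dualMap_eq_finrank_range (Algebra.lsmul k k L a : Module.End k L)

variable (P : Type u) [AddCommGroup P] [Module k P] [Module Aᵐᵒᵖ P] [IsScalarTower k Aᵐᵒᵖ P]

instance [Module.Finite k P] [Module.Finite k L] : Module.Finite k (BalancedTensor k A P L) :=
  inferInstance

variable (k A L) in
/-- The adjunction between the tensor product over `A` and homomorphisms into a dual. -/
def homDualEquiv : (P →ₗ[Aᵐᵒᵖ] DualModule k A L) ≃ₗ[k] Module.Dual k (BalancedTensor k A P L) where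
  toFun f := Submodule.liftQ _ (TensorProduct.lift
      (show P →ₗ[k] L →ₗ[k] k from f.restrictScalars k)) <| by
    refine Submodule.span_le.2 ?_
    rintro _ ⟨x, a, y, rfl⟩
    change TensorProduct.lift _ _ = 0
    rw [map_sub, sub_eq_zero]
    exact LinearMap.congr_fun (map_smul f (op a) x) y
  map_add' f g := balancedTensor_ext fun _ _ => rfl
  map_smul' r f := balancedTensor_ext fun _ _ => rfl
  invFun h :=
    { toFun := fun x => h ∘ₗ Submodule.mkQ _ ∘ₗ TensorProduct.mk k P L x
      map_add' := fun x y => LinearMap.ext fun z =>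
        (congrArg (h ∘ₗ Submodule.mkQ _) (TensorProduct.add_tmul x y z)).trans (map_add _ _ _)
      map_smul' := fun a x => LinearMap.ext fun z => by
        refine congrArg h ((Submodule.Quotient.eq _).2 (Submodule.subset_span ?_))
        exact ⟨x, unop a, z, rfl⟩ }
  left_inv f := rfl
  right_inv h := balancedTensor_ext fun _ _ => rfl

variable {P}

theorem homDualEquiv_conj (α : Module.End Aᵐᵒᵖ P) (β : Module.End A L) :
    (homDualEquiv k A L P).conj (homEnd k α (dualEnd β)) =
      Module.Dual.transpose (balancedMap k α β) :=
  LinearMap.ext fun _ => balancedTensor_ext fun _ _ => rfl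

theorem trace_homEnd_dualEnd [Module.Finite k P] [Module.Finite k L] (α : Module.End Aᵐᵒᵖ P)
    (β : Module.End A L) : LinearMap.trace k _ (homEnd k α (dualEnd (k := k) β)) =
      LinearMap.trace k _ (balancedMap k α β) := by
  rw [← LinearMap.trace_conj' _ (homDualEquiv k A L P), homDualEquiv_conj]
  exact LinearMap.congr_fun
    (LinearMap.trace_transpose (R := k) (M := BalancedTensor k A P L)) _

theorem finrank_hom_dualModule [Module.Finite k P] [Module.Finite k L] :
    Module.finrank k (P →ₗ[Aᵐᵒᵖ] DualModule k A L) =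
      Module.finrank k (BalancedTensor k A P L) := by
  rw [(homDualEquiv k A L P).finrank_eq]
  exact Subspace.dual_finrank_eq

end Duality

/-! ### Tensoring with the left ideal generated by an idempotent -/

section PrincipalModules

variable {k A : Type u} [Field k] [Ring A] [Algebra k A]

/-- The left ideal generated by an element, as a left module. -/
abbrev principalModule (a : A) : Submodule A A := LinearMap.range (LinearMap.toSpanSingleton A A a)

variable {P : Type u} [AddCommGroup P] [Module k P] [Module Aᵐᵒᵖ P] [IsScalarTower k Aᵐᵒᵖ P]

theorem mul_of_mem_principalModule {a : A} (ha : IsIdempotentElem a) {x : A}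
    (hx : x ∈ principalModule a) : x * a = x := by
  obtain ⟨y, rfl⟩ := hx
  change y * a * a = y * a
  rw [mul_assoc, ha.eq]

variable (k P) in
/-- For an idempotent `a`, the tensor product `P ⊗_A A a` is `P a`. -/
def tensorPrincipalEquiv {a : A} (ha : IsIdempotentElem a) :
    BalancedTensor k A P (principalModule a) ≃ₗ[k] LinearMap.range (rightAction k P a) :=
  LinearEquiv.ofLinearMap
    (Submodule.liftQ _ (TensorProduct.lift (LinearMap.mk₂ k
        (fun (x : P) (y : principalModule a) =>
          (⟨op (y : A) • x, op (y : A) • x, by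
            change op a • op (y : A) • x = _
            rw [← mul_smul, ← op_mul, mul_of_mem_principalModule ha y.2]⟩ :
            LinearMap.range (rightAction k P a)))
        (fun x x' y => Subtype.ext (smul_add _ _ _))
        (fun c x y => Subtype.ext (smul_comm _ _ _))
        (fun x y y' => Subtype.ext (add_smul (op (y : A)) (op (y' : A)) x))
        (fun c x y => Subtype.ext (smul_assoc c (op (y : A)) x)))) <| by
      refine Submodule.span_le.2 ?_
      rintro _ ⟨x, b, y, rfl⟩
      change TensorProduct.lift _ _ = 0
      rw [map_sub, sub_eq_zero]
      exact Subtype.ext (mul_smul (op (y : A)) (op b) x).symm)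
    -- The inverse is `z ↦ z ⊗ a`; it works because `x ⊗ y = x ⊗ y a = x y ⊗ a` for `y` in `A a`.
    (Submodule.mkQ _ ∘ₗ (TensorProduct.mk k P (principalModule a)).flip
      ⟨a, 1, one_smul A a⟩ ∘ₗ Submodule.subtype _)
    (LinearMap.ext fun x => Subtype.ext <| by
      obtain ⟨_, x, rfl⟩ := x
      change op a • op a • x = op a • x
      rw [← mul_smul, ← op_mul, ha.eq])
    (balancedTensor_ext fun x y => (Submodule.Quotient.eq _).2 <| by
      refine Submodule.subset_span ⟨x, y, ⟨a, 1, one_smul A a⟩, ?_⟩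
      exact congrArg (fun z : principalModule a =>
          (op (y : A) • x) ⊗ₜ[k] (⟨a, 1, one_smul A a⟩ : principalModule a) - x ⊗ₜ[k] z)
        (Subtype.ext (mul_of_mem_principalModule ha y.2).symm))

theorem trace_balancedMap_principalModule [Module.Finite k A] [Module.Finite k P] {a : A}
    (ha : IsIdempotentElem a) (α : Module.End Aᵐᵒᵖ P) :
    LinearMap.trace k _ (balancedMap k α (LinearMap.id : Module.End A (principalModule a))) =
      weightedTrace k a α := by
  have hα : ∀ x ∈ LinearMap.range (rightAction k P a),
      α.restrictScalars k x ∈ LinearMap.range (rightAction k P a) := by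
    rintro _ ⟨x, rfl⟩
    exact ⟨α x, (map_smul α _ _).symm⟩
  rw [← LinearMap.trace_conj' _ (tensorPrincipalEquiv k P ha), weightedTrace,
    ← trace_restrict_range_of_isIdempotentElem _ (isIdempotentElem_rightAction ha) _ hα]
  congr 1
  refine LinearMap.ext fun x => Subtype.ext ?_
  obtain ⟨_, x, rfl⟩ := x
  change op a • α (op a • x) = α (op a • x)
  rw [← map_smul, ← mul_smul, ← op_mul, ha.eq]

/-- The subspace `b A a` for idempotents, as the range of `b` on `A a`. -/
theorem finrank_range_lsmul_principalModule [Module.Finite k A] (a b : A) :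
    Module.finrank k (LinearMap.range (Algebra.lsmul k k (principalModule a) b :
      Module.End k (principalModule a))) = Module.finrank k (corner k A b a) := by
  have h : corner k A b a = (LinearMap.range (Algebra.lsmul k k (principalModule a) b :
      Module.End k (principalModule a))).map ((principalModule a).subtype.restrictScalars k) := by
    ext x
    constructor
    · rintro ⟨y, rfl⟩
      exact ⟨_, ⟨⟨y * a, y, rfl⟩, rfl⟩, rfl⟩
    · rintro ⟨_, ⟨⟨_, y, rfl⟩, rfl⟩, rfl⟩
      exact ⟨y, rfl⟩
  rw [h]
  exact (LinearEquiv.finrank_eq (Submodule.equivMapOfInjective _ Subtype.val_injective _))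

end PrincipalModules

/-! ### The Cartan matrix relates traces on `P e_i` to traces on `Hom_A(P, S_j)` -/

section Cartan

variable {k A : Type u} [Field k] [Ring A] [Algebra k A] [Module.Finite k A]
variable {n : ℕ} {e : Fin n → A} {χ : Fin n → A →ₐ[k] k}
variable {P : Type u} [AddCommGroup P] [Module k P] [Module Aᵐᵒᵖ P] [IsScalarTower k Aᵐᵒᵖ P]
  [Module.Finite k P] [Module.Projective Aᵐᵒᵖ P]

theorem trace_homEnd (he : CompleteOrthogonalIdempotents e) (hχ : IsDualCharacters e χ)
    {N : Type u} [AddCommGroup N] [Module k N] [Module Aᵐᵒᵖ N] [IsScalarTower k Aᵐᵒᵖ N]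
    [Module.Finite k N] (α : Module.End Aᵐᵒᵖ P) (β : Module.End Aᵐᵒᵖ N) :
    LinearMap.trace k _ (homEnd k α β) =
      ∑ j, weightedTrace k (e j) β *
        LinearMap.trace k _ (homEnd k α (LinearMap.id : Module.End Aᵐᵒᵖ (CharacterModule (χ j)))) :=
  (endInductive_trace_homEnd hχ α).forall_end he hχ _ N β le_rfl

/-- The space `P e_i = P ⊗_A A e_i` has the dimension of its dual `Hom_A(P, D(A e_i))`, and
dévissage of `D(A e_i)` counts `S_j` with multiplicity `dim e_j A e_i`. -/
theorem finrank_range_rightAction_eq (he : CompleteOrthogonalIdempotents e)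
    (hχ : IsDualCharacters e χ) (i : Fin n) :
    Module.finrank k (LinearMap.range (rightAction k P (e i))) =
      ∑ j, Module.finrank k (corner k A (e j) (e i)) *
        Module.finrank k (P →ₗ[Aᵐᵒᵖ] CharacterModule (χ j)) := by
  rw [← (tensorPrincipalEquiv k P (he.idem i)).finrank_eq, ← finrank_hom_dualModule,
    (endInductive_finrank_hom (P := P) he hχ).forall_end he hχ _ _ 0 le_rfl]
  exact Finset.sum_congr rfl fun j _ => by
    rw [finrank_range_rightAction_dualModule, finrank_range_lsmul_principalModule]

/-- The trace form of the same computation: the weight of the identity of `D(A e_i)` at `e_j` is the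
trace of the idempotent `e_j` on `A e_i`, hence its rank, a Cartan entry. -/
theorem weightedTrace_eq_sum (he : CompleteOrthogonalIdempotents e)
    (hχ : IsDualCharacters e χ) (α : Module.End Aᵐᵒᵖ P) (i : Fin n) :
    weightedTrace k (e i) α = ∑ j, (cartanMatrix k e i j : k) *
        LinearMap.trace k _
          (homEnd k α (LinearMap.id : Module.End Aᵐᵒᵖ (CharacterModule (χ j)))) := by
  rw [← trace_balancedMap_principalModule (he.idem i), ← trace_homEnd_dualEnd, trace_homEnd he hχ]
  refine Finset.sum_congr rfl fun j _ => ?_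
  congr 1
  rw [weightedTrace_dualEnd]
  change LinearMap.trace k _ (Algebra.lsmul k k (principalModule (e i)) (e j) :
      Module.End k (principalModule (e i))) = _
  rw [trace_of_isIdempotentElem, finrank_range_lsmul_principalModule]
  · change _ = ((Module.finrank k (corner k A (e j) (e i)) : ℤ) : k)
    rw [Int.cast_natCast]
  · rw [IsIdempotentElem, ← map_mul, (he.idem j).eq]

end Cartan

/-! ### Bounded resolutions by finitely generated projectives -/

section Resolutions

open ShortComplex

universe v w

variable {C : Type w} [Category.{v} C] [Abelian C]

/-- The augmentation of a projective resolution. -/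
def resolutionAugmentation {K : C} (Q : ProjectiveResolution K) : Q.complex.X 0 ⟶ K := Q.π.f 0

instance {K : C} (Q : ProjectiveResolution K) : Epi (resolutionAugmentation Q) :=
  inferInstanceAs (Epi (Q.π.f 0))

theorem d_comp_resolutionAugmentation {K : C} (Q : ProjectiveResolution K) :
    Q.complex.d 1 0 ≫ resolutionAugmentation Q = 0 := Q.complex_d_comp_π_f_zero

theorem resolutionAugmentation_exact {K : C} (Q : ProjectiveResolution K) :
    (ShortComplex.mk _ _ (d_comp_resolutionAugmentation Q)).Exact := Q.exact₀

/-- The complex obtained by splicing a short exact sequence with a resolution of its kernel. -/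
def spliceComplex (S : ShortComplex C) (Q : ProjectiveResolution S.X₁) : ChainComplex C ℕ :=
  Q.complex.augment (resolutionAugmentation Q ≫ S.f)
    (by rw [← Category.assoc, d_comp_resolutionAugmentation, Limits.zero_comp])

variable {S : ShortComplex C}

theorem spliceComplex_exactAt_succ (hS : S.ShortExact) (Q : ProjectiveResolution S.X₁) (l : ℕ) :
    (spliceComplex S Q).ExactAt (l + 1) := by
  have := hS.mono_f
  rw [HomologicalComplex.exactAt_iff' _ (l + 2) (l + 1) l (by simp) (by simp)]
  -- In degree `1` the differential is the augmentation followed by the monomorphism `S.f`, which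
  -- leaves the kernel unchanged; above that the complex is `Q`.
  cases l with
  | zero =>
    let φ : ShortComplex.mk _ _ (d_comp_resolutionAugmentation Q) ⟶
        (spliceComplex S Q).sc' 2 1 0 :=
      { τ₁ := 𝟙 (Q.complex.X 1)
        τ₂ := 𝟙 (Q.complex.X 0)
        τ₃ := S.f
        comm₁₂ := (Category.id_comp _).trans (Category.comp_id _).symm
        comm₂₃ := Category.id_comp _ }
    have : Epi φ.τ₁ := inferInstanceAs (Epi (𝟙 _))
    have : IsIso φ.τ₂ := inferInstanceAs (IsIso (𝟙 _))
    have : Mono φ.τ₃ := inferInstanceAs (Mono S.f)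
    exact (ShortComplex.exact_iff_of_epi_of_isIso_of_mono φ).1 (resolutionAugmentation_exact Q)
  | succ l => exact Q.exact_succ l

theorem splice_zero (Q : ProjectiveResolution S.X₁) :
    (resolutionAugmentation Q ≫ S.f) ≫ S.g = 0 := by
  rw [Category.assoc, S.zero, Limits.comp_zero]

/-- The augmentation of the spliced complex. -/
def spliceAugmentation (Q : ProjectiveResolution S.X₁) :
    spliceComplex S Q ⟶ (ChainComplex.single₀ C).obj S.X₃ :=
  (ChainComplex.toSingle₀Equiv (spliceComplex S Q) S.X₃).symm ⟨S.g, splice_zero Q⟩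

theorem spliceAugmentation_f_zero (Q : ProjectiveResolution S.X₁) :
    (spliceAugmentation Q).f 0 = S.g :=
  ChainComplex.toSingle₀Equiv_symm_apply_f_zero (C := spliceComplex S Q) S.g (splice_zero Q)

/-- Splicing a short exact sequence with projective middle term and a projective resolution of its
kernel. -/
def spliceResolution (hS : S.ShortExact) (Q : ProjectiveResolution S.X₁) [Projective S.X₂] :
    ProjectiveResolution S.X₃ where
  complex := spliceComplex S Q
  projective l := by
    cases l with
    | zero => exact inferInstanceAs (Projective S.X₂)
    | succ l => exact Q.projective l
  π := spliceAugmentation Q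
  quasiIso := ⟨fun l => by
    have := hS.epi_g
    cases l with
    | zero =>
      rw [ChainComplex.quasiIsoAt₀_iff, ShortComplex.quasiIso_iff_of_zeros']
      -- Precomposing `S.f` with the epimorphic augmentation does not change its image, so exactness
      -- descends from `S`.
      · let φ : ShortComplex.mk (resolutionAugmentation Q ≫ S.f) S.g (splice_zero Q) ⟶ S :=
          { τ₁ := resolutionAugmentation Q
            τ₂ := 𝟙 _
            τ₃ := 𝟙 _ }
        have : Epi φ.τ₁ := inferInstanceAs (Epi (resolutionAugmentation Q))
        have : IsIso φ.τ₂ := inferInstanceAs (IsIso (𝟙 _))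
        have : Mono φ.τ₃ := inferInstanceAs (Mono (𝟙 _))
        refine (ShortComplex.exact_and_epi_g_iff_of_iso ?_).2
          ⟨(ShortComplex.exact_iff_of_epi_of_isIso_of_mono φ).2 hS.exact, hS.epi_g⟩
        exact ShortComplex.isoMk (Iso.refl _) (Iso.refl _) (Iso.refl _)
          ((Category.id_comp _).trans (Category.comp_id _).symm)
          ((Category.id_comp S.g).trans ((spliceAugmentation_f_zero Q).symm.trans
            (Category.comp_id ((spliceAugmentation Q).f 0)).symm))
      all_goals rfl
    | succ l =>
      rw [quasiIsoAt_iff_exactAt']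
      · exact spliceComplex_exactAt_succ hS Q l
      · exact ChainComplex.exactAt_succ_single_obj _ _⟩

/-- The short exact sequence of a surjective linear map. -/
theorem shortExact_ker {R : Type u} [Ring R] {F M : Type u} [AddCommGroup F] [Module R F]
    [AddCommGroup M] [Module R M] (f : F →ₗ[R] M) (hf : Function.Surjective f) :
    (ShortComplex.mk (ModuleCat.ofHom (LinearMap.ker f).subtype) (ModuleCat.ofHom f)
      (by ext x; exact x.2)).ShortExact := by
  refine ShortComplex.ShortExact.mk' ?_ ?_ ?_
  · rw [ShortComplex.moduleCat_exact_iff_range_eq_ker]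
    exact Submodule.range_subtype _
  · rw [ModuleCat.mono_iff_injective]
    exact Subtype.val_injective
  · rw [ModuleCat.epi_iff_surjective]
    exact hf

/-- Over a noetherian ring the kernel of a finite free cover is again finitely generated, and its
projective dimension bound is one smaller; its resolution is spliced with the cover. -/
theorem exists_finite_resolution {R : Type u} [Ring R] [IsNoetherianRing R] (d : ℕ) :
    ∀ (M : ModuleCat.{u} R) [Module.Finite R M], HasProjectiveDimensionLE M d →
      ∃ P : ProjectiveResolution M, (∀ l, Module.Finite R (P.complex.X l)) ∧
        ∀ l, d < l → Subsingleton (P.complex.X l) := by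
  induction d with
  | zero =>
    intro M _ hM
    have : Projective M := (projective_iff_hasProjectiveDimensionLE_zero M).2 hM
    have h0 : ∀ l, 0 < l → Subsingleton (((ChainComplex.single₀ (ModuleCat.{u} R)).obj M).X l) :=
      fun l hl => ModuleCat.subsingleton_of_isZero
        (HomologicalComplex.isZero_single_obj_X _ _ _ _ hl.ne')
    refine ⟨ProjectiveResolution.self M, fun l => ?_, h0⟩
    cases l with
    | zero => exact inferInstanceAs (Module.Finite R M)
    | succ l =>
      have : Subsingleton ((ProjectiveResolution.self M).complex.X (l + 1)) := h0 _ l.succ_pos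
      exact Module.Finite.of_finite
  | succ d ih =>
    intro M _ hM
    obtain ⟨s, f, hf⟩ := Module.Finite.exists_fin' R M
    have hS := shortExact_ker f hf
    have h2 : Projective (ModuleCat.of R (Fin s → R)) := inferInstance
    obtain ⟨Q, hQ, hQ0⟩ := ih (ModuleCat.of R (LinearMap.ker f))
      ((hS.hasProjectiveDimensionLT_X₃_iff d h2).1 hM)
    refine ⟨spliceResolution hS Q, fun l => ?_, fun l hl => ?_⟩
    · cases l with
      | zero => exact inferInstanceAs (Module.Finite R (Fin s → R))
      | succ l => exact hQ l
    · cases l with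
      | zero => omega
      | succ l => exact hQ0 l (by omega)

end Resolutions

/-! ### Invertibility of the Cartan matrix over the integers -/

section CartanInvertible

theorem cartanInv_mul {k A : Type u} [Field k] [Ring A] [Algebra k A] {n : ℕ} {e : Fin n → A}
    (h : IsUnit (cartanMatrix k e).det) :
    cartanInv k e * (cartanMatrix k e).map (Int.cast : ℤ → k) = 1 := by
  rw [cartanInv]
  have := Matrix.map_mul (L := (cartanMatrix k e)⁻¹) (M := cartanMatrix k e)
    (f := Int.castRingHom k)
  rw [Matrix.nonsing_inv_mul _ h] at this
  exact this.symm.trans (Matrix.map_one _ (map_zero _) (map_one _))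

variable {k A : Type u} [Field k] [Ring A] [Algebra k A] [Module.Finite k A]
variable {n : ℕ} {e : Fin n → A} {χ : Fin n → A →ₐ[k] k}

/-- Dimension vectors are additive, so by induction on projective dimension they all lie in the
integral column span of the Cartan matrix, as those of projectives do. -/
theorem exists_cartanMatrix_mulVec (he : CompleteOrthogonalIdempotents e)
    (hχ : IsDualCharacters e χ) (d : ℕ) : ∀ (M : Type u) [AddCommGroup M] [Module k M]
      [Module Aᵐᵒᵖ M] [IsScalarTower k Aᵐᵒᵖ M] [Module.Finite k M],
      HasProjectiveDimensionLE (ModuleCat.of Aᵐᵒᵖ M) d → ∃ r : Fin n → ℤ, ∀ i,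
        (Module.finrank k (LinearMap.range (rightAction k M (e i))) : ℤ) =
          ∑ j, cartanMatrix k e i j * r j := by
  induction d with
  | zero =>
    intro M _ _ _ _ _ hM
    have : Projective (ModuleCat.of Aᵐᵒᵖ M) := (projective_iff_hasProjectiveDimensionLE_zero _).2 hM
    have : Module.Projective Aᵐᵒᵖ M := (IsProjective.iff_projective M).2 this
    refine ⟨fun j => Module.finrank k (M →ₗ[Aᵐᵒᵖ] CharacterModule (χ j)), fun i => ?_⟩
    rw [finrank_range_rightAction_eq he hχ, Nat.cast_sum]
    exact Finset.sum_congr rfl fun j _ => Nat.cast_mul _ _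
  | succ d ih =>
    intro M _ _ _ _ _ hM
    have : Module.Finite Aᵐᵒᵖ M := Module.Finite.of_restrictScalars_finite k Aᵐᵒᵖ M
    obtain ⟨s, f, hf⟩ := Module.Finite.exists_fin' Aᵐᵒᵖ M
    have hS := shortExact_ker f hf
    have hF : Projective (ModuleCat.of Aᵐᵒᵖ (Fin s → Aᵐᵒᵖ)) := inferInstance
    have : Module.Finite k (LinearMap.ker f) := Module.Finite.of_injective
      ((LinearMap.ker f).subtype.restrictScalars k) Subtype.val_injective
    obtain ⟨r, hr⟩ := ih (LinearMap.ker f) ((hS.hasProjectiveDimensionLT_X₃_iff d hF).1 hM)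
    -- The coefficients of a quotient are those of its free cover minus those of the kernel.
    refine ⟨fun j => Module.finrank k ((Fin s → Aᵐᵒᵖ) →ₗ[Aᵐᵒᵖ] CharacterModule (χ j)) - r j,
      fun i => ?_⟩
    have h1 := finrank_range_rightAction_of_exact (k := k) (LinearMap.ker f).subtype f
      Subtype.val_injective f.exact_subtype_ker_map hf (he.idem i)
    have h2 := finrank_range_rightAction_eq (P := Fin s → Aᵐᵒᵖ) he hχ i
    have h3 : (Module.finrank k (LinearMap.range (rightAction k (Fin s → Aᵐᵒᵖ) (e i))) : ℤ) =
        ∑ j, cartanMatrix k e i j *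
          Module.finrank k ((Fin s → Aᵐᵒᵖ) →ₗ[Aᵐᵒᵖ] CharacterModule (χ j)) := by
      rw [h2, Nat.cast_sum]
      exact Finset.sum_congr rfl fun j _ => Nat.cast_mul _ _
    simp only [mul_sub, Finset.sum_sub_distrib, ← h3, ← hr i, h1]
    push_cast
    ring

/-- The dimension vectors of the one-dimensional modules are the unit vectors, so their coefficients
form an integral right inverse. -/
theorem isUnit_det_cartanMatrix (he : CompleteOrthogonalIdempotents e)
    (hχ : IsDualCharacters e χ) (hgd : HasFiniteGlobalDimension A) :
    IsUnit (cartanMatrix k e).det := by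
  obtain ⟨d, hd⟩ := hgd
  choose r hr using fun j => exists_cartanMatrix_mulVec he hχ d (CharacterModule (χ j)) (hd _)
  have h : cartanMatrix k e * Matrix.of (fun i j => r j i) = 1 := by
    ext i j
    rw [Matrix.mul_apply]
    refine (hr j i).symm.trans ?_
    rw [finrank_range_rightAction_characterModule hχ, Matrix.one_apply]
    simp only [eq_comm (a := j)]
    split_ifs <;> rfl
  exact Matrix.isUnit_det_of_right_inverse h

end CartanInvertible

/-! ### The trace formulas for a projective module -/

section ProjectiveTraces

variable {k A : Type u} [Field k] [Ring A] [Algebra k A] [Module.Finite k A]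
variable {n : ℕ} {e : Fin n → A} {χ : Fin n → A →ₐ[k] k}
variable {P : Type u} [AddCommGroup P] [Module k P] [Module Aᵐᵒᵖ P] [IsScalarTower k Aᵐᵒᵖ P]
  [Module.Finite k P] [Module.Projective Aᵐᵒᵖ P]

/-- Inverts the linear system of `weightedTrace_eq_sum`. -/
theorem trace_homEnd_characterModule (he : CompleteOrthogonalIdempotents e)
    (hχ : IsDualCharacters e χ) (h : IsUnit (cartanMatrix k e).det) (α : Module.End Aᵐᵒᵖ P)
    (j : Fin n) :
    LinearMap.trace k _ (homEnd k α (LinearMap.id : Module.End Aᵐᵒᵖ (CharacterModule (χ j)))) =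
      ∑ i, cartanInv k e j i * weightedTrace k (e i) α := by
  have h1 := congrArg (Matrix.mulVec (cartanInv k e)) (funext (weightedTrace_eq_sum he hχ α))
  have h2 : (fun i => ∑ j, (cartanMatrix k e i j : k) * LinearMap.trace k _
      (homEnd k α (LinearMap.id : Module.End Aᵐᵒᵖ (CharacterModule (χ j))))) =
      ((cartanMatrix k e).map (Int.cast : ℤ → k)).mulVec (fun j => LinearMap.trace k _
      (homEnd k α (LinearMap.id : Module.End Aᵐᵒᵖ (CharacterModule (χ j))))) := rfl
  rw [h2, Matrix.mulVec_mulVec, cartanInv_mul h, Matrix.one_mulVec] at h1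
  exact (congrFun h1 j).symm

theorem trace_homEnd_eq (he : CompleteOrthogonalIdempotents e)
    (hχ : IsDualCharacters e χ) (h : IsUnit (cartanMatrix k e).det)
    {N : Type u} [AddCommGroup N] [Module k N] [Module Aᵐᵒᵖ N] [IsScalarTower k Aᵐᵒᵖ N]
    [Module.Finite k N] (α : Module.End Aᵐᵒᵖ P) (β : Module.End Aᵐᵒᵖ N) :
    LinearMap.trace k _ (homEnd k α β) =
      ∑ i, (∑ j, weightedTrace k (e j) β * cartanInv k e j i) * weightedTrace k (e i) α := by
  rw [trace_homEnd he hχ]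
  simp only [trace_homEnd_characterModule he hχ h, Finset.mul_sum, Finset.sum_mul, mul_assoc]
  exact Finset.sum_comm

/-- The Hom formula applied to the dual of `L`, traces being unchanged by duality. -/
theorem trace_balancedMap_eq (he : CompleteOrthogonalIdempotents e)
    (hχ : IsDualCharacters e χ) (h : IsUnit (cartanMatrix k e).det)
    {L : Type u} [AddCommGroup L] [Module k L] [Module A L] [IsScalarTower k A L]
    [Module.Finite k L] (α : Module.End Aᵐᵒᵖ P) (β : Module.End A L) :
    LinearMap.trace k _ (balancedMap k α β) =
      ∑ i, (∑ j, LinearMap.trace k L (Algebra.lsmul k k L (e j) ∘ₗ β.restrictScalars k) *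
        cartanInv k e j i) * weightedTrace k (e i) α := by
  rw [← trace_homEnd_dualEnd, trace_homEnd_eq he hχ h]
  refine Finset.sum_congr rfl fun i _ => ?_
  congr 1
  exact Finset.sum_congr rfl fun j _ => by rw [weightedTrace_dualEnd]

end ProjectiveTraces

/-! ### Weighted traces along a projective resolution -/

section ResolvedTraces

variable {k A : Type u} [Field k] [Ring A] [Algebra k A]

attribute [local instance] ModuleCat.moduleOfAlgebraModule
  ModuleCat.isScalarTower_of_algebra_moduleCat

theorem alternating_sum_eq_of_exact {R : Type*} [CommRing R] (v z : ℕ → R) (t : R)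
    (h0 : v 0 = z 0 + t) (hs : ∀ l, v (l + 1) = z (l + 1) + z l) (D : ℕ) :
    ∑ l ∈ Finset.range (D + 1), (-1) ^ l * v l = t + (-1) ^ D * z D := by
  induction D with
  | zero => simp [h0, add_comm]
  | succ D ih => rw [Finset.sum_range_succ, ih, hs, pow_succ]; ring

variable {M : Type u} [AddCommGroup M] [Module k M] [Module Aᵐᵒᵖ M] [IsScalarTower k Aᵐᵒᵖ M]
  (P : ProjectiveResolution (ModuleCat.of Aᵐᵒᵖ M))

/-- The lift of an endomorphism of a module to a projective resolution. -/
abbrev liftEnd (α : Module.End Aᵐᵒᵖ M) : P.complex ⟶ P.complex :=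
  ProjectiveResolution.lift (ModuleCat.ofHom α) P P

theorem liftEnd_comm (α : Module.End Aᵐᵒᵖ M) (i j : ℕ) (x : P.complex.X i) :
    ((liftEnd P α).f j).hom ((P.complex.d i j).hom x) =
      (P.complex.d i j).hom (((liftEnd P α).f i).hom x) :=
  (LinearMap.congr_fun (congrArg ModuleCat.Hom.hom ((liftEnd P α).comm i j)) x).symm

theorem liftEnd_augmentation (α : Module.End Aᵐᵒᵖ M) (x : P.complex.X 0) :
    (resolutionAugmentation P).hom (((liftEnd P α).f 0).hom x) =
      α ((resolutionAugmentation P).hom x) :=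
  LinearMap.congr_fun (congrArg ModuleCat.Hom.hom
    (ProjectiveResolution.lift_commutes_zero (ModuleCat.ofHom α) P P)) x

/-- The resolution breaks into short exact sequences through the images `Z l` of the differentials,
all stable under the lift of `α`; their contributions cancel in the alternating sum, up to degree
`D`, where everything is zero. -/
theorem weightedTrace_eq_alternating_sum (hfin : ∀ l, Module.Finite k (P.complex.X l)) {D : ℕ}
    (hD : Subsingleton (P.complex.X D)) (a : A) (α : Module.End Aᵐᵒᵖ M) :
    weightedTrace k a α = ∑ l ∈ Finset.range D,
      (-1) ^ l * weightedTrace k a ((liftEnd P α).f l).hom := by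
  let Z : ∀ l, Submodule Aᵐᵒᵖ (P.complex.X l) := fun l => LinearMap.range (P.complex.d (l + 1) l).hom
  have hZ : ∀ l, ∀ x ∈ Z l, ((liftEnd P α).f l).hom x ∈ Z l := by
    rintro l _ ⟨x, rfl⟩
    exact ⟨_, (liftEnd_comm P α _ _ x).symm⟩
  have hsum := alternating_sum_eq_of_exact
    (fun l => weightedTrace k a ((liftEnd P α).f l).hom)
    (fun l => weightedTrace k a (((liftEnd P α).f l).hom.restrict (hZ l)))
    (weightedTrace k a α)
    (weightedTrace_of_exact (Z 0).subtype (resolutionAugmentation P).hom Subtype.val_injective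
      (LinearMap.exact_iff.2 ?_)
      ((ModuleCat.epi_iff_surjective _).1 inferInstance) (by ext; rfl)
      (LinearMap.ext fun x => (liftEnd_augmentation P α x).symm) a)
    (fun l => weightedTrace_of_exact (Z (l + 1)).subtype (P.complex.d (l + 1) l).hom.rangeRestrict
      Subtype.val_injective (LinearMap.exact_iff.2 ?_) (LinearMap.surjective_rangeRestrict _)
      (by ext; rfl) (LinearMap.ext fun x => Subtype.ext (liftEnd_comm P α _ _ x)) a) D
  · have : Subsingleton (Z D) := inferInstance
    rw [Finset.sum_range_succ, weightedTrace_of_subsingleton a ((liftEnd P α).f D).hom,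
      weightedTrace_of_subsingleton a (((liftEnd P α).f D).hom.restrict (hZ D)), mul_zero,
      add_zero, add_zero] at hsum
    exact hsum.symm
  · rw [Submodule.range_subtype]
    exact ((ShortComplex.moduleCat_exact_iff_range_eq_ker _).1 (resolutionAugmentation_exact P)).symm
  · rw [Submodule.range_subtype, LinearMap.ker_rangeRestrict]
    exact ((ShortComplex.moduleCat_exact_iff_range_eq_ker _).1 (P.exact_succ l)).symm

end ResolvedTraces

/-! ### The Hopf trace formula for Ext -/

section ExtTraces

variable {k A : Type u} [Field k] [Ring A] [Algebra k A]

attribute [local instance] ModuleCat.moduleOfAlgebraModule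
  ModuleCat.isScalarTower_of_algebra_moduleCat

variable {M : Type u} [AddCommGroup M] [Module Aᵐᵒᵖ M]
  {N : Type u} [AddCommGroup N] [Module k N] [Module Aᵐᵒᵖ N] [IsScalarTower k Aᵐᵒᵖ N]
  (P : ProjectiveResolution (ModuleCat.of Aᵐᵒᵖ M))

variable (k N) in
/-- Pre-composition with a homomorphism. -/
def homPre {X Y : Type u} [AddCommGroup X] [AddCommGroup Y] [Module Aᵐᵒᵖ X] [Module Aᵐᵒᵖ Y]
    (g : X →ₗ[Aᵐᵒᵖ] Y) : (Y →ₗ[Aᵐᵒᵖ] N) →ₗ[k] (X →ₗ[Aᵐᵒᵖ] N) where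
  toFun f := f ∘ₗ g
  map_add' _ _ := LinearMap.add_comp _ _ _
  map_smul' _ _ := LinearMap.smul_comp _ _ _

variable (k N) in
/-- The space of cocycles of degree `l` in the complex `Hom_A(P, N)`. -/
abbrev homCocycles (l : ℕ) : Submodule k (P.complex.X l →ₗ[Aᵐᵒᵖ] N) :=
  LinearMap.ker (homPre k N (P.complex.d (l + 1) l).hom)

theorem d_comp_homCocycle {l : ℕ} (f : homCocycles k N P l) :
    P.complex.d (l + 1) l ≫ ModuleCat.ofHom (Y := N) f.1 = 0 :=
  ModuleCat.hom_ext f.2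

variable (k N) in
/-- The class in `Ext` of a cocycle. -/
def extClassOfCocycle (l : ℕ) : homCocycles k N P l →ₗ[k] ExtSpace A M N l where
  toFun f := P.extMk (ModuleCat.ofHom (Y := N) f.1) (l + 1) rfl (d_comp_homCocycle P f)
  map_add' f g := (P.add_extMk _ _ _ rfl (d_comp_homCocycle P f) (d_comp_homCocycle P g)).symm
  map_smul' r f := by
    rw [RingHom.id_apply, Abelian.Ext.smul_eq_comp_mk₀, P.extMk_comp_mk₀]
    congr 1
    ext x
    exact (algebraMap_smul Aᵐᵒᵖ r (f.1 x)).symm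

theorem extClassOfCocycle_surjective (l : ℕ) :
    Function.Surjective (extClassOfCocycle k N P l) := fun x => by
  obtain ⟨f, hf, rfl⟩ := P.extMk_surjective x (l + 1) rfl
  exact ⟨⟨f.hom, congrArg ModuleCat.Hom.hom hf⟩, rfl⟩

/-- In degree `0` there are no nonzero coboundaries: they would factor through the term of the
resolution in cochain degree `1`, which is zero. -/
theorem extMk_zero_injective {C : Type*} [Category* C] [Abelian C] [HasExt C] {X Y : C}
    (R : ProjectiveResolution X) (f : R.complex.X 0 ⟶ Y) (hf : R.complex.d 1 0 ≫ f = 0)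
    (h : R.extMk f 1 rfl hf = 0) : f = 0 := by
  simp only [← R.extEquivCohomologyClass.apply_eq_iff_eq,
    ProjectiveResolution.extEquivCohomologyClass_extMk,
    ProjectiveResolution.extEquivCohomologyClass_zero,
    CochainComplex.HomComplex.CohomologyClass.mk_eq_zero_iff] at h
  rw [CochainComplex.HomComplex.Cocycle.toSingleMk_mem_coboundaries_iff _ _ _ _ _ 1 (by simp)] at h
  obtain ⟨g, hg⟩ := h
  rw [(CochainComplex.isZero_of_isStrictlyLE R.cochainComplex 0 1).eq_of_src g 0,
    Limits.comp_zero] at hg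
  exact (cancel_epi (R.cochainComplexXIso (-(0 : ℕ)) 0 rfl).hom).1
    (hg.symm.trans Limits.comp_zero.symm)

theorem extClassOfCocycle_zero_injective :
    Function.Injective (extClassOfCocycle k N P 0) :=
  (injective_iff_map_eq_zero _).2 fun f hf => Subtype.ext <|
    congrArg ModuleCat.Hom.hom (extMk_zero_injective P _ (d_comp_homCocycle P f) hf)

/-- The differential of the complex `Hom_A(P, N)`. -/
def homDifferential (l : ℕ) : (P.complex.X l →ₗ[Aᵐᵒᵖ] N) →ₗ[k] homCocycles k N P (l + 1) :=
  (homPre k N (P.complex.d (l + 1) l).hom).codRestrict _ fun f => by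
    refine LinearMap.ext fun x => ?_
    have := LinearMap.congr_fun
      (congrArg ModuleCat.Hom.hom (P.complex.d_comp_d (l + 2) (l + 1) l)) x
    exact (congrArg f this).trans (map_zero f)

theorem homDifferential_exact (l : ℕ) : Function.Exact (homDifferential (k := k) (N := N) P l)
    (extClassOfCocycle k N P (l + 1)) := fun f => by
  refine (P.extMk_eq_zero_iff _ (l + 2) rfl (d_comp_homCocycle P f) l rfl).trans ⟨?_, ?_⟩
  · rintro ⟨g, hg⟩
    exact ⟨g.hom, Subtype.ext (congrArg ModuleCat.Hom.hom hg)⟩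
  · rintro ⟨g, rfl⟩
    exact ⟨ModuleCat.ofHom (Y := N) g, rfl⟩

variable (k) in
/-- The endomorphism `Ext^l(α, β)`. -/
abbrev extMap (α : Module.End Aᵐᵒᵖ M) (β : Module.End Aᵐᵒᵖ N) (l : ℕ) :
    Module.End k (ExtSpace A M N l) :=
  extPre k M N l (op α) ∘ₗ extPost k M N l β

/-- The lift of an endomorphism as a morphism of resolutions. -/
def liftEndHom (α : Module.End Aᵐᵒᵖ M) : ProjectiveResolution.Hom P P (ModuleCat.ofHom α) where
  hom := liftEnd P α
  hom_f_zero_comp_π_f_zero :=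
    HomologicalComplex.congr_hom (ProjectiveResolution.lift_commutes (ModuleCat.ofHom α) P P) 0

theorem homEnd_mem_homCocycles (α : Module.End Aᵐᵒᵖ M) (β : Module.End Aᵐᵒᵖ N) (l : ℕ) :
    ∀ f ∈ homCocycles k N P l,
      homEnd k ((liftEnd P α).f l).hom β f ∈ homCocycles k N P l := fun f hf =>
  LinearMap.ext fun x => by
    change β (f (((liftEnd P α).f l).hom ((P.complex.d (l + 1) l).hom x))) = 0
    rw [liftEnd_comm]
    exact (congrArg β (LinearMap.congr_fun hf _)).trans (map_zero β)

/-- On cocycles `Ext^l(α, β)` is induced by `f ↦ β f α'`, with `α'` the lift of `α` to the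
resolution. -/
theorem extMap_extClassOfCocycle (α : Module.End Aᵐᵒᵖ M) (β : Module.End Aᵐᵒᵖ N) (l : ℕ)
    (f : homCocycles k N P l) :
    extMap k α β l (extClassOfCocycle k N P l f) = extClassOfCocycle k N P l
      ((homEnd k ((liftEnd P α).f l).hom β).restrict (homEnd_mem_homCocycles P α β l) f) := by
  change (Abelian.Ext.mk₀ (ModuleCat.ofHom α)).comp ((P.extMk (ModuleCat.ofHom (Y := N) f.1)
    (l + 1) rfl (d_comp_homCocycle P f)).comp (Abelian.Ext.mk₀ (ModuleCat.ofHom β)) (add_zero l))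
    (zero_add l) = _
  rw [P.extMk_comp_mk₀, ProjectiveResolution.mk₀_comp_extMk _ _ _ _ (liftEndHom P α)]
  rfl

variable [Module.Finite k N]

theorem finite_extSpace (hfin : ∀ l, Module.Finite k (P.complex.X l)) (l : ℕ) :
    Module.Finite k (ExtSpace A M N l) :=
  Module.Finite.of_surjective _ (extClassOfCocycle_surjective (k := k) (N := N) P l)

theorem subsingleton_extSpace {l : ℕ} (h : Subsingleton (P.complex.X l)) :
    Subsingleton (ExtSpace A M N l) := ⟨fun x y => by
  obtain ⟨f, hf, rfl⟩ := P.extMk_surjective x (l + 1) rfl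
  obtain ⟨g, hg, rfl⟩ := P.extMk_surjective y (l + 1) rfl
  congr 1
  exact ModuleCat.hom_ext (LinearMap.ext fun z => by
    rw [Subsingleton.elim z 0, map_zero, map_zero])⟩

theorem alternating_sum_trace_extMap (hfin : ∀ l, Module.Finite k (P.complex.X l)) {D : ℕ}
    (hD : Subsingleton (P.complex.X D)) (α : Module.End Aᵐᵒᵖ M) (β : Module.End Aᵐᵒᵖ N) :
    ∑ l ∈ Finset.range D, (-1) ^ l * LinearMap.trace k _ (extMap k α β l) =
      ∑ l ∈ Finset.range D,
        (-1) ^ l * LinearMap.trace k _ (homEnd k ((liftEnd P α).f l).hom β) := by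
  have hE := fun l => finite_extSpace (k := k) (N := N) P hfin l
  -- The four-term sequences are `0 → Z^l → Hom(P_l, N) → Z^{l+1} → Ext^{l+1} → 0`, and `Ext^0` is
  -- `Z^0`.
  have hsum := alternating_sum_eq_of_cochain
    (fun l => LinearMap.trace k _ (homEnd k ((liftEnd P α).f l).hom β))
    (fun l => LinearMap.trace k _ ((homEnd k ((liftEnd P α).f l).hom β).restrict
      (homEnd_mem_homCocycles P α β l)))
    (fun l => LinearMap.trace k _ (extMap k α β l)) ?_
    (fun l => trace_of_exact_four (homCocycles k N P l).subtype (homDifferential P l)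
      (extClassOfCocycle k N P (l + 1)) Subtype.val_injective ?_ (homDifferential_exact P l)
      (extClassOfCocycle_surjective P (l + 1)) _ _ _ _ (by ext; rfl) ?_ ?_) D
  · have h1 : Subsingleton (ExtSpace A M N D) := subsingleton_extSpace P hD
    rw [Finset.sum_range_succ, Subsingleton.elim (extMap k α β D) 0,
      Subsingleton.elim (LinearMap.restrict _ (homEnd_mem_homCocycles P α β D)) 0, map_zero,
      map_zero, mul_zero, add_zero, sub_zero] at hsum
    exact hsum.symm
  · let E := LinearEquiv.ofBijective (extClassOfCocycle k N P 0)
      ⟨extClassOfCocycle_zero_injective P, extClassOfCocycle_surjective P 0⟩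
    refine (congrArg _ ?_).trans (LinearMap.trace_conj' _ E)
    refine LinearMap.ext fun x => ?_
    obtain ⟨f, rfl⟩ := E.surjective x
    rw [LinearEquiv.conj_apply_apply, E.symm_apply_apply]
    exact extMap_extClassOfCocycle P α β 0 f
  · rw [LinearMap.exact_iff, Submodule.range_subtype]
    exact LinearMap.ker_codRestrict _ _ _
  · refine LinearMap.ext fun f => Subtype.ext (LinearMap.ext fun x => ?_)
    exact congrArg (fun y => β (f y)) (liftEnd_comm P α _ _ x).symm
  · exact LinearMap.ext fun f => extMap_extClassOfCocycle P α β (l + 1) f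

end ExtTraces

/-! ### The Hopf trace formula for chain complexes -/

section HomologyTraces

variable {k : Type u} [Field k] (K : ChainComplex (ModuleCat.{u} k) ℕ)

theorem iCycles_injective (l : ℕ) : Function.Injective (K.iCycles l).hom :=
  (ModuleCat.mono_iff_injective _).1 inferInstance

theorem homologyπ_surjective (l : ℕ) : Function.Surjective (K.homologyπ l).hom :=
  (ModuleCat.epi_iff_surjective _).1 inferInstance

theorem finite_homology (hfin : ∀ l, Module.Finite k (K.X l)) (l : ℕ) :
    Module.Finite k (K.homology l) :=
  have : Module.Finite k (K.cycles l) := Module.Finite.of_injective _ (iCycles_injective K l)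
  Module.Finite.of_surjective _ (homologyπ_surjective K l)

theorem subsingleton_homology {l : ℕ} (h : Subsingleton (K.X l)) : Subsingleton (K.homology l) :=
  have : Subsingleton (K.cycles l) := (iCycles_injective K l).subsingleton
  (homologyπ_surjective K l).subsingleton

/-- The map to cycles has the same kernel as the differential, from which it differs by the
monomorphism `iCycles`. -/
theorem iCycles_toCycles_exact (l : ℕ) :
    Function.Exact (K.iCycles (l + 1)).hom (K.toCycles (l + 1) l).hom := by
  have h := (ShortComplex.moduleCat_exact_iff_range_eq_ker _).1
    (ShortComplex.exact_of_f_is_kernel (ShortComplex.mk _ _ (K.iCycles_d (l + 1) l))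
      (K.cyclesIsKernel (l + 1) l (by simp)))
  rw [LinearMap.exact_iff]
  refine Eq.trans ?_ h.symm
  change _ = LinearMap.ker (K.d (l + 1) l).hom
  rw [← K.toCycles_i, ModuleCat.hom_comp,
    LinearMap.ker_comp_of_ker_eq_bot _ (LinearMap.ker_eq_bot.2 (iCycles_injective K l))]

theorem toCycles_homologyπ_exact (l : ℕ) :
    Function.Exact (K.toCycles (l + 1) l).hom (K.homologyπ l).hom := by
  have h := (ShortComplex.moduleCat_exact_iff_range_eq_ker _).1
    (ShortComplex.exact_of_g_is_cokernel
      (ShortComplex.mk _ _ (K.toCycles_comp_homologyπ (l + 1) l))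
      (K.homologyIsCokernel (l + 1) l (by simp)))
  exact LinearMap.exact_iff.2 h.symm

/-- The Hopf trace formula for a bounded complex of finite-dimensional vector spaces. -/
theorem alternating_sum_trace_homology (hfin : ∀ l, Module.Finite k (K.X l)) {D : ℕ}
    (hD : Subsingleton (K.X D)) (g : K ⟶ K) :
    ∑ l ∈ Finset.range D,
        (-1) ^ l * LinearMap.trace k _ (HomologicalComplex.homologyMap g l).hom =
      ∑ l ∈ Finset.range D, (-1) ^ l * LinearMap.trace k _ (g.f l).hom := by
  have hZ : ∀ l, Module.Finite k (K.cycles l) := fun l =>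
    Module.Finite.of_injective _ (iCycles_injective K l)
  have hi : ∀ l, (g.f l).hom ∘ₗ (K.iCycles l).hom =
      (K.iCycles l).hom ∘ₗ (HomologicalComplex.cyclesMap g l).hom := fun l =>
    (congrArg ModuleCat.Hom.hom (HomologicalComplex.cyclesMap_i g l)).symm
  have hsum := alternating_sum_eq_of_chain
    (fun l => LinearMap.trace k _ (g.f l).hom)
    (fun l => LinearMap.trace k _ (HomologicalComplex.cyclesMap g l).hom)
    (fun l => LinearMap.trace k _ (HomologicalComplex.homologyMap g l).hom) ?_
    (fun l => trace_of_exact_four (K.iCycles (l + 1)).hom (K.toCycles (l + 1) l).hom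
      (K.homologyπ l).hom (iCycles_injective K _) (iCycles_toCycles_exact K l)
      (toCycles_homologyπ_exact K l) (homologyπ_surjective K l) _ _ _ _ (hi _) ?_
      (congrArg ModuleCat.Hom.hom (HomologicalComplex.homologyπ_naturality g l))) D
  · have h1 : Subsingleton (K.cycles D) := (iCycles_injective K D).subsingleton
    rw [Finset.sum_range_succ, Subsingleton.elim (g.f D).hom 0,
      Subsingleton.elim (HomologicalComplex.cyclesMap g D).hom 0, map_zero,
      map_zero, mul_zero, add_zero, add_zero] at hsum
    exact hsum.symm
  · have : IsIso (K.iCycles 0) := K.isIso_iCycles 0 0 (by simp) (by simp)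
    let E := (asIso (K.iCycles 0)).toLinearEquiv
    refine (congrArg _ ?_).trans (LinearMap.trace_conj' _ E)
    refine LinearMap.ext fun x => ?_
    obtain ⟨y, rfl⟩ := E.surjective x
    rw [LinearEquiv.conj_apply_apply, E.symm_apply_apply]
    exact LinearMap.congr_fun (hi 0) y
  · have h : K.toCycles (l + 1) l ≫ HomologicalComplex.cyclesMap g l =
        g.f (l + 1) ≫ K.toCycles (l + 1) l := by
      rw [← cancel_mono (K.iCycles l)]
      simp
    exact congrArg ModuleCat.Hom.hom h

end HomologyTraces

/-! ### The Hopf trace formula for Tor -/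

section TorTraces

variable {k A : Type u} [Field k] [Ring A] [Algebra k A]

attribute [local instance] ModuleCat.moduleOfAlgebraModule
  ModuleCat.isScalarTower_of_algebra_moduleCat

variable {M : Type u} [AddCommGroup M] [Module Aᵐᵒᵖ M]
  {N : Type u} [AddCommGroup N] [Module k N] [Module A N] [IsScalarTower k A N]
  (P : ProjectiveResolution (ModuleCat.of Aᵐᵒᵖ M))

variable (k) in
/-- The endomorphism `Tor_l(α, β)`. -/
abbrev torMap (α : Module.End Aᵐᵒᵖ M) (β : Module.End A N) (l : ℕ) :
    Module.End k (TorSpace k A M N l) :=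
  torLeft k M N l α ∘ₗ torRight k M N l β

variable (k N) in
/-- The complex `P ⊗_A N`. -/
abbrev tensorComplex : ChainComplex (ModuleCat.{u} k) ℕ :=
  ((tensorFunctor k A N).mapHomologicalComplex _).obj P.complex

variable (k N) in
/-- The isomorphism of `Tor_l(M, N)` with the homology of `P ⊗_A N`. -/
def torEquiv (l : ℕ) : TorSpace k A M N l ≃ₗ[k] (tensorComplex k N P).homology l :=
  (P.isoLeftDerivedObj (tensorFunctor k A N) l).toLinearEquiv

variable (k) in
/-- The endomorphism of `P ⊗_A N` given by endomorphisms of `M` and `N`. -/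
def tensorComplexEnd (α : Module.End Aᵐᵒᵖ M) (β : Module.End A N) :
    tensorComplex k N P ⟶ tensorComplex k N P :=
  (NatTrans.mapHomologicalComplex (tensorNat k β) _).app P.complex ≫
    ((tensorFunctor k A N).mapHomologicalComplex _).map (liftEnd P α)

theorem tensorComplexEnd_f (α : Module.End Aᵐᵒᵖ M) (β : Module.End A N) (l : ℕ) :
    ((tensorComplexEnd k P α β).f l).hom = balancedMap k ((liftEnd P α).f l).hom β :=
  balancedTensor_ext fun _ _ => rfl

/-- Naturality in both variables of the computation of Tor by the given resolution `P`; it lets the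
chosen resolution in the derived functor be replaced by the bounded one. -/
theorem torEquiv_conj (α : Module.End Aᵐᵒᵖ M) (β : Module.End A N) (l : ℕ) :
    (torEquiv k N P l).conj (torMap k α β l) =
      (HomologicalComplex.homologyMap (tensorComplexEnd k P α β) l).hom := by
  have h : (NatTrans.leftDerived (tensorNat k β) l).app (ModuleCat.of Aᵐᵒᵖ M) ≫
      ((tensorFunctor k A N).leftDerived l).map (ModuleCat.ofHom α) ≫
      (P.isoLeftDerivedObj (tensorFunctor k A N) l).hom =
      (P.isoLeftDerivedObj (tensorFunctor k A N) l).hom ≫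
        HomologicalComplex.homologyMap (tensorComplexEnd k P α β) l := by
    rw [P.leftDerived_app_eq, P.isoLeftDerivedObj_hom_naturality (ModuleCat.ofHom α) P (liftEnd P α)
      (ProjectiveResolution.lift_commutes_zero (ModuleCat.ofHom α) P P)]
    simp only [Category.assoc, Iso.inv_hom_id_assoc]
    rw [tensorComplexEnd, HomologicalComplex.homologyMap_comp]
    rfl
  refine LinearMap.ext fun x => ?_
  obtain ⟨y, rfl⟩ := (torEquiv k N P l).surjective x
  rw [LinearEquiv.conj_apply_apply, LinearEquiv.symm_apply_apply]
  exact LinearMap.congr_fun (congrArg ModuleCat.Hom.hom h) y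

theorem subsingleton_balancedTensor {k A X N : Type u} [Field k] [Ring A] [AddCommGroup N]
    [Module k N] [Module A N] [AddCommGroup X] [Module k X] [Module Aᵐᵒᵖ X]
    [Subsingleton X] : Subsingleton (BalancedTensor k A X N) :=
  have : Subsingleton (X ⊗[k] N) := inferInstance
  inferInstance

theorem subsingleton_torSpace {l : ℕ} (h : Subsingleton (P.complex.X l)) :
    Subsingleton (TorSpace k A M N l) :=
  have := subsingleton_homology (tensorComplex k N P) (l := l) subsingleton_balancedTensor
  (torEquiv k N P l).toEquiv.subsingleton

variable [Module.Finite k N]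

theorem finite_torSpace (hfin : ∀ l, Module.Finite k (P.complex.X l)) (l : ℕ) :
    Module.Finite k (TorSpace k A M N l) :=
  have := finite_homology (tensorComplex k N P)
    (fun l => inferInstanceAs (Module.Finite k (BalancedTensor k A (P.complex.X l) N))) l
  Module.Finite.equiv (torEquiv k N P l).symm

theorem alternating_sum_trace_torMap (hfin : ∀ l, Module.Finite k (P.complex.X l)) {D : ℕ}
    (hD : Subsingleton (P.complex.X D)) (α : Module.End Aᵐᵒᵖ M) (β : Module.End A N) :
    ∑ l ∈ Finset.range D, (-1) ^ l * LinearMap.trace k _ (torMap k α β l) =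
      ∑ l ∈ Finset.range D,
        (-1) ^ l * LinearMap.trace k _ (balancedMap k ((liftEnd P α).f l).hom β) := by
  simp only [← LinearMap.trace_conj' (torMap k α β _) (torEquiv k N P _), torEquiv_conj]
  rw [alternating_sum_trace_homology (tensorComplex k N P)
    (fun l => inferInstanceAs (Module.Finite k (BalancedTensor k A (P.complex.X l) N)))
    subsingleton_balancedTensor]
  exact Finset.sum_congr rfl fun l _ => by rw [tensorComplexEnd_f]; rfl

end TorTraces

/-! ### The formulas for one-sided modules -/

section RightModules

variable {k A : Type u} [Field k] [Ring A] [Algebra k A] [Module.Finite k A]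
variable {n : ℕ} {e : Fin n → A} {χ : Fin n → A →ₐ[k] k}

attribute [local instance] ModuleCat.moduleOfAlgebraModule
  ModuleCat.isScalarTower_of_algebra_moduleCat

theorem exists_bounded_resolution (hgd : HasFiniteGlobalDimension A) (M : Type u)
    [AddCommGroup M] [Module k M] [Module Aᵐᵒᵖ M] [IsScalarTower k Aᵐᵒᵖ M] [Module.Finite k M] :
    ∃ (P : ProjectiveResolution (ModuleCat.of Aᵐᵒᵖ M)) (D : ℕ),
      (∀ l, Module.Finite k (P.complex.X l)) ∧ ∀ l, D ≤ l → Subsingleton (P.complex.X l) := by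
  obtain ⟨d, hd⟩ := hgd
  have : IsNoetherianRing Aᵐᵒᵖ := IsNoetherianRing.of_finite k Aᵐᵒᵖ
  have : Module.Finite Aᵐᵒᵖ (ModuleCat.of Aᵐᵒᵖ M) := Module.Finite.of_restrictScalars_finite k Aᵐᵒᵖ M
  obtain ⟨P, hP, hP0⟩ := exists_finite_resolution d (ModuleCat.of Aᵐᵒᵖ M) (hd _)
  exact ⟨P, d + 1, fun l => Module.Finite.trans Aᵐᵒᵖ _, fun l hl => hP0 l hl⟩

/-- The formula for projectives is linear in the weighted traces of the first endomorphism. Summed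
over a resolution with signs, these become the weighted traces of `α` on `M` itself. -/
theorem trace_ext_eq (he : CompleteOrthogonalIdempotents e) (hχ : IsDualCharacters e χ)
    (hgd : HasFiniteGlobalDimension A) (M N : Type u)
    [AddCommGroup M] [Module k M] [Module Aᵐᵒᵖ M] [IsScalarTower k Aᵐᵒᵖ M] [Module.Finite k M]
    [AddCommGroup N] [Module k N] [Module Aᵐᵒᵖ N] [IsScalarTower k Aᵐᵒᵖ N] [Module.Finite k N] :
    (∀ l, Module.Finite k (ExtSpace A M N l)) ∧ ∃ D, (∀ l, D ≤ l → Subsingleton (ExtSpace A M N l)) ∧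
      ∀ (α : Module.End Aᵐᵒᵖ M) (β : Module.End Aᵐᵒᵖ N),
        ∑ l ∈ Finset.range D, (-1) ^ l * LinearMap.trace k _ (extMap k α β l) =
          ∑ i, (∑ j, weightedTrace k (e j) β * cartanInv k e j i) * weightedTrace k (e i) α := by
  obtain ⟨P, D, hfin, hD⟩ := exists_bounded_resolution (k := k) hgd M
  refine ⟨finite_extSpace P hfin, D, fun l hl => subsingleton_extSpace P (hD l hl),
    fun α β => ?_⟩
  have hdet := isUnit_det_cartanMatrix he hχ hgd
  have hP : ∀ l, Module.Projective Aᵐᵒᵖ (P.complex.X l) := fun l =>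
    (IsProjective.iff_projective _).2 (P.projective l)
  rw [alternating_sum_trace_extMap P hfin (hD D le_rfl)]
  simp only [trace_homEnd_eq he hχ hdet,
    weightedTrace_eq_alternating_sum P hfin (hD D le_rfl) _ α, Finset.mul_sum]
  rw [Finset.sum_comm]
  exact Finset.sum_congr rfl fun i _ => Finset.sum_congr rfl fun l _ => mul_left_comm _ _ _

theorem trace_tor_eq (he : CompleteOrthogonalIdempotents e) (hχ : IsDualCharacters e χ)
    (hgd : HasFiniteGlobalDimension A) (M N : Type u)
    [AddCommGroup M] [Module k M] [Module Aᵐᵒᵖ M] [IsScalarTower k Aᵐᵒᵖ M] [Module.Finite k M]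
    [AddCommGroup N] [Module k N] [Module A N] [IsScalarTower k A N] [Module.Finite k N] :
    (∀ l, Module.Finite k (TorSpace k A M N l)) ∧
      ∃ D, (∀ l, D ≤ l → Subsingleton (TorSpace k A M N l)) ∧
      ∀ (α : Module.End Aᵐᵒᵖ M) (β : Module.End A N),
        ∑ l ∈ Finset.range D, (-1) ^ l * LinearMap.trace k _ (torMap k α β l) =
          ∑ i, (∑ j, LinearMap.trace k N (Algebra.lsmul k k N (e j) ∘ₗ β.restrictScalars k) *
            cartanInv k e j i) * weightedTrace k (e i) α := by
  obtain ⟨P, D, hfin, hD⟩ := exists_bounded_resolution (k := k) hgd M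
  refine ⟨finite_torSpace P hfin, D, fun l hl => subsingleton_torSpace P (hD l hl),
    fun α β => ?_⟩
  have hdet := isUnit_det_cartanMatrix he hχ hgd
  have hP : ∀ l, Module.Projective Aᵐᵒᵖ (P.complex.X l) := fun l =>
    (IsProjective.iff_projective _).2 (P.projective l)
  rw [alternating_sum_trace_torMap P hfin (hD D le_rfl)]
  simp only [trace_balancedMap_eq he hχ hdet,
    weightedTrace_eq_alternating_sum P hfin (hD D le_rfl) _ α, Finset.mul_sum]
  rw [Finset.sum_comm]
  exact Finset.sum_congr rfl fun i _ => Finset.sum_congr rfl fun l _ => mul_left_comm _ _ _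

end RightModules

/-! ### Entries of trace matrices as traces on the whole bimodule -/

section TraceMatrices

variable {k A B : Type u} [Field k] [Ring A] [Algebra k A] [Ring B] [Algebra k B]
variable {M : Type u} [AddCommGroup M] [Module k M] [Module B M] [Module Aᵐᵒᵖ M]
  [SMulCommClass B Aᵐᵒᵖ M] [IsScalarTower k B M] [IsScalarTower k Aᵐᵒᵖ M] [Module.Finite k M]
variable {n m : ℕ} {e : Fin n → A} {f : Fin m → B}

/-- The corner is the image of an idempotent operator, because the two actions commute. -/
theorem traceMatrix_apply (he : ∀ i, IsIdempotentElem (e i)) (hf : ∀ j, IsIdempotentElem (f j))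
    (φ : BimoduleEnd k A B M) (i : Fin n) (j : Fin m) :
    traceMatrix e f φ i j = LinearMap.trace k M (φ.toLinearMap ∘ₗ
      (Algebra.lsmul k k M (f j) ∘ₗ Algebra.lsmul k k M (op (e i)))) := by
  refine trace_restrict_range_of_isIdempotentElem _ ?_ _ _
  refine LinearMap.ext fun x => ?_
  change f j • op (e i) • f j • op (e i) • x = f j • op (e i) • x
  rw [← smul_comm (f j) (op (e i)), ← mul_smul, (hf j).eq, ← mul_smul, ← op_mul, (he i).eq]

theorem traceMatrix_of_subsingleton {M : Type u} [AddCommGroup M] [Module k M] [Module B M]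
    [Module Aᵐᵒᵖ M] [IsScalarTower k B M] [IsScalarTower k Aᵐᵒᵖ M] [Subsingleton M] (φ : BimoduleEnd k A B M) :
    traceMatrix e f φ = 0 := by
  ext i j
  refine (congrArg (LinearMap.trace k (corner k M (f j) (e i))) ?_).trans (map_zero _)
  exact Subsingleton.elim _ _

/-- The idempotent of `B` is absorbed into an `A`-linear endomorphism, and that of `A` remains as
the weight. -/
theorem weightedTrace_toRight_mul (he : ∀ i, IsIdempotentElem (e i))
    (hf : ∀ j, IsIdempotentElem (f j)) (φ : BimoduleEnd k A B M) (i : Fin n) (j : Fin m) :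
    weightedTrace k (e i) (φ.toRight * Module.toModuleEnd Aᵐᵒᵖ M (f j)) =
      traceMatrix e f φ i j :=
  (traceMatrix_apply he hf φ i j).symm

/-- The mirror case, used for the second argument of Tor: the right idempotent is absorbed, the left
one is the weight. -/
theorem trace_toLeft_mul (he : ∀ i, IsIdempotentElem (e i))
    (hf : ∀ j, IsIdempotentElem (f j)) (φ : BimoduleEnd k A B M) (i : Fin n) (j : Fin m) :
    LinearMap.trace k M (Algebra.lsmul k k M (f j) ∘ₗ
      (φ.toLeft * rightMulEnd B A M (op (e i))).restrictScalars k) = traceMatrix e f φ i j := by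
  rw [traceMatrix_apply he hf]
  congr 1
  exact LinearMap.ext fun x => (φ.map_left (f j) (op (e i) • x)).symm

theorem finsum_traceMatrix {T : ℕ → Type u} [∀ l, AddCommGroup (T l)] [∀ l, Module k (T l)]
    [∀ l, Module B (T l)] [∀ l, Module Aᵐᵒᵖ (T l)] [∀ l, SMulCommClass B Aᵐᵒᵖ (T l)]
    [∀ l, IsScalarTower k B (T l)] [∀ l, IsScalarTower k Aᵐᵒᵖ (T l)]
    [∀ l, Module.Finite k (T l)] {D : ℕ} (hD : ∀ l, D ≤ l → Subsingleton (T l))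
    (Φ : ∀ l, BimoduleEnd k A B (T l)) (i : Fin n) (j : Fin m) :
    (∑ᶠ l : ℕ, (-1 : k) ^ l • traceMatrix e f (Φ l)) i j =
      ∑ l ∈ Finset.range D, (-1) ^ l * traceMatrix e f (Φ l) i j := by
  rw [finsum_eq_sum_of_support_subset (s := Finset.range D), Matrix.sum_apply]
  · rfl
  · intro l hl
    by_contra h
    have := hD l (by simpa using h)
    exact hl (by simp [traceMatrix_of_subsingleton])

theorem finite_setOf_nontrivial {T : ℕ → Type u} {D : ℕ} (hD : ∀ l, D ≤ l → Subsingleton (T l)) :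
    {l : ℕ | Nontrivial (T l)}.Finite :=
  (Finset.range D).finite_toSet.subset fun l hl => by
    by_contra h
    have := hD l (by simpa using h)
    exact not_subsingleton_iff_nontrivial.2 hl this

end TraceMatrices

/-! ### Reduction from bimodules to one-sided modules -/

section Bimodules

theorem extPre_comp_extPost_comp_comm {k A M N : Type u} [Field k] [Ring A] [Algebra k A]
    [AddCommGroup M] [AddCommGroup N] [Module Aᵐᵒᵖ M] [Module Aᵐᵒᵖ N] (l : ℕ)
    (a d : (Module.End Aᵐᵒᵖ M)ᵐᵒᵖ) (b c : Module.End Aᵐᵒᵖ N) :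
    (extPre k M N l a ∘ₗ extPost k M N l b) ∘ₗ (extPost k M N l c ∘ₗ extPre k M N l d) =
      (extPre k M N l a * extPre k M N l d) ∘ₗ (extPost k M N l b * extPost k M N l c) :=
  LinearMap.ext fun x => congrArg (extPre k M N l a)
    ((congrArg (extPost k M N l b) (extPre_extPost_comm k M N l d c x).symm).trans
      (extPre_extPost_comm k M N l d b (extPost k M N l c x)).symm)

theorem torLeft_comp_torRight_comp_comm {k A M N : Type u} [Field k] [Ring A] [Algebra k A]
    [AddCommGroup M] [AddCommGroup N] [Module Aᵐᵒᵖ M] [Module k N] [Module A N]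
    [IsScalarTower k A N] (l : ℕ) (a c : Module.End Aᵐᵒᵖ M) (b d : Module.End A N) :
    (torLeft k M N l a ∘ₗ torRight k M N l b) ∘ₗ (torLeft k M N l c ∘ₗ torRight k M N l d) =
      (torLeft k M N l a * torLeft k M N l c) ∘ₗ (torRight k M N l b * torRight k M N l d) :=
  LinearMap.ext fun x => congrArg (torLeft k M N l a)
    (torLeft_torRight_comm k M N l c b (torRight k M N l d x)).symm

variable {k A B C : Type u} [Field k] [Ring A] [Algebra k A] [Ring B] [Algebra k B] [Ring C]
  [Algebra k C] {n m p : ℕ} {e : Fin n → A} {f : Fin m → B} {g : Fin p → C}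
variable {M : Type u} [AddCommGroup M] [Module k M] [Module B M] [Module Aᵐᵒᵖ M]
  [SMulCommClass B Aᵐᵒᵖ M] [IsScalarTower k B M] [IsScalarTower k Aᵐᵒᵖ M]

/-- The idempotents of `B` and `C` act on Ext through `M` and `N`, so by functoriality an entry is
the trace of a single map `Ext^l(φ f_j, ψ g_r)`. -/
theorem traceMatrix_extEnd (hf : ∀ j, IsIdempotentElem (f j)) (hg : ∀ j, IsIdempotentElem (g j))
    {N : Type u} [AddCommGroup N] [Module k N] [Module C N] [Module Aᵐᵒᵖ N]
    [SMulCommClass C Aᵐᵒᵖ N] [IsScalarTower k C N] [IsScalarTower k Aᵐᵒᵖ N]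
    (φ : BimoduleEnd k A B M) (ψ : BimoduleEnd k A C N) (l : ℕ)
    [Module.Finite k (ExtBimodule k A B C M N l)] (j : Fin m) (r : Fin p) :
    traceMatrix f g (extEnd φ ψ l) j r = LinearMap.trace k (ExtSpace A M N l)
      (extMap k (φ.toRight * Module.toModuleEnd Aᵐᵒᵖ M (f j))
        (ψ.toRight * Module.toModuleEnd Aᵐᵒᵖ N (g r)) l) := by
  rw [traceMatrix_apply hf hg]
  -- Passing to the opposite reverses products, so this uses that `φ` commutes with the action of `f
  -- j`.
  have h : op (φ.toRight * Module.toModuleEnd Aᵐᵒᵖ M (f j)) =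
      op φ.toRight * op (Module.toModuleEnd Aᵐᵒᵖ M (f j)) :=
    congrArg op (LinearMap.ext fun x => φ.map_left (f j) x)
  refine congrArg (LinearMap.trace k (ExtSpace A M N l)) ?_
  rw [extMap, h, map_mul, map_mul]
  exact extPre_comp_extPost_comp_comm (A := A) l _ _ _ _

theorem traceMatrix_torEnd (hf : ∀ j, IsIdempotentElem (f j)) (hg : ∀ j, IsIdempotentElem (g j))
    {N : Type u} [AddCommGroup N] [Module k N] [Module A N] [Module Cᵐᵒᵖ N]
    [SMulCommClass A Cᵐᵒᵖ N] [IsScalarTower k A N] [IsScalarTower k Cᵐᵒᵖ N]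
    (φ : BimoduleEnd k A B M) (ψ : BimoduleEnd k C A N) (l : ℕ)
    [Module.Finite k (TorBimodule k A B C M N l)] (j : Fin m) (r : Fin p) :
    traceMatrix g f (torEnd φ ψ l) r j = LinearMap.trace k (TorSpace k A M N l)
      (torMap k (φ.toRight * Module.toModuleEnd Aᵐᵒᵖ M (f j))
        (ψ.toLeft * rightMulEnd A C N (op (g r))) l) := by
  rw [traceMatrix_apply hg hf]
  refine congrArg (LinearMap.trace k (TorSpace k A M N l)) ?_
  rw [torMap, map_mul, map_mul]
  exact torLeft_comp_torRight_comp_comm l _ _ _ _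

end Bimodules

end

end LefschetzBimodule

theorem theorem7 {k A B C : Type u} [Field k]
    [Ring A] [Algebra k A] [Module.Finite k A]
    [Ring B] [Algebra k B] [Module.Finite k B]
    [Ring C] [Algebra k C] [Module.Finite k C]
    (hA : LefschetzBimodule.IsElementary k A)
    (hB : LefschetzBimodule.IsElementary k B)
    (hC : LefschetzBimodule.IsElementary k C)
    (hgd : LefschetzBimodule.HasFiniteGlobalDimension A)
    {n m p : ℕ} (e : Fin n → A) (f : Fin m → B) (g : Fin p → C)
    (he : LefschetzBimodule.IsCompletePrimitive e)
    (hf : LefschetzBimodule.IsCompletePrimitive f)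
    (hg : LefschetzBimodule.IsCompletePrimitive g) :
    -- the Cartan matrix of `A` is invertible over the integers
    IsUnit (LefschetzBimodule.cartanMatrix k e).det ∧
    -- cohomological formula, for a `B`-`A`-bimodule `M` and a `C`-`A`-bimodule `N`
    (∀ (M : Type u) [AddCommGroup M] [Module k M] [Module.Finite k M]
        [Module B M] [Module Aᵐᵒᵖ M] [SMulCommClass B Aᵐᵒᵖ M]
        [IsScalarTower k B M] [IsScalarTower k Aᵐᵒᵖ M]
        (N : Type u) [AddCommGroup N] [Module k N] [Module.Finite k N]
        [Module C N] [Module Aᵐᵒᵖ N] [SMulCommClass C Aᵐᵒᵖ N]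
        [IsScalarTower k C N] [IsScalarTower k Aᵐᵒᵖ N]
        (φ : LefschetzBimodule.BimoduleEnd k A B M) (ψ : LefschetzBimodule.BimoduleEnd k A C N),
      (∀ l : ℕ, Module.Finite k (LefschetzBimodule.ExtBimodule k A B C M N l)) ∧
      {l : ℕ | Nontrivial (LefschetzBimodule.ExtBimodule k A B C M N l)}.Finite ∧
      ∑ᶠ l : ℕ, (-1 : k) ^ l •
          LefschetzBimodule.traceMatrix f g (LefschetzBimodule.extEnd φ ψ l) =
        (LefschetzBimodule.traceMatrix e f φ).transpose *
          (LefschetzBimodule.cartanInv k e).transpose *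
          LefschetzBimodule.traceMatrix e g ψ) ∧
    -- homological formula, for a `B`-`A`-bimodule `M` and an `A`-`C`-bimodule `N`
    (∀ (M : Type u) [AddCommGroup M] [Module k M] [Module.Finite k M]
        [Module B M] [Module Aᵐᵒᵖ M] [SMulCommClass B Aᵐᵒᵖ M]
        [IsScalarTower k B M] [IsScalarTower k Aᵐᵒᵖ M]
        (N : Type u) [AddCommGroup N] [Module k N] [Module.Finite k N]
        [Module A N] [Module Cᵐᵒᵖ N] [SMulCommClass A Cᵐᵒᵖ N]
        [IsScalarTower k A N] [IsScalarTower k Cᵐᵒᵖ N]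
        (φ : LefschetzBimodule.BimoduleEnd k A B M) (ψ : LefschetzBimodule.BimoduleEnd k C A N),
      (∀ l : ℕ, Module.Finite k (LefschetzBimodule.TorBimodule k A B C M N l)) ∧
      {l : ℕ | Nontrivial (LefschetzBimodule.TorBimodule k A B C M N l)}.Finite ∧
      ∑ᶠ l : ℕ, (-1 : k) ^ l •
          LefschetzBimodule.traceMatrix g f (LefschetzBimodule.torEnd φ ψ l) =
        LefschetzBimodule.traceMatrix g e ψ *
          LefschetzBimodule.cartanInv k e *
          LefschetzBimodule.traceMatrix e f φ) := by
  classical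
  obtain ⟨χ, hχ⟩ := LefschetzBimodule.exists_isDualCharacters hA he
  have he' := he.complete.idem
  have hf' := hf.complete.idem
  have hg' := hg.complete.idem
  refine ⟨LefschetzBimodule.isUnit_det_cartanMatrix he.complete hχ hgd, ?_, ?_⟩
  · intro M _ _ _ _ _ _ _ _ N _ _ _ _ _ _ _ _ φ ψ
    obtain ⟨hfin, D, hD, hsum⟩ :=
      LefschetzBimodule.trace_ext_eq he.complete hχ hgd M N
    have hfin' : ∀ l, Module.Finite k (LefschetzBimodule.ExtBimodule k A B C M N l) := hfin
    refine ⟨hfin', LefschetzBimodule.finite_setOf_nontrivial hD, ?_⟩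
    ext j r
    refine (LefschetzBimodule.finsum_traceMatrix
      (T := LefschetzBimodule.ExtBimodule k A B C M N) hD
      (LefschetzBimodule.extEnd φ ψ) j r).trans ?_
    simp only [LefschetzBimodule.traceMatrix_extEnd hf' hg', hsum,
      LefschetzBimodule.weightedTrace_toRight_mul he' hf',
      LefschetzBimodule.weightedTrace_toRight_mul he' hg', Matrix.mul_apply,
      Matrix.transpose_apply, Finset.sum_mul]
    -- The one-sided formula sums over the index of `φ` outside and that of `ψ` inside; the matrix
    -- product, as expanded, has the opposite order.
    rw [Finset.sum_comm]
    exact Finset.sum_congr rfl fun b _ => Finset.sum_congr rfl fun a _ => by ring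
  · intro M _ _ _ _ _ _ _ _ N _ _ _ _ _ _ _ _ φ ψ
    obtain ⟨hfin, D, hD, hsum⟩ :=
      LefschetzBimodule.trace_tor_eq he.complete hχ hgd M N
    have hfin' : ∀ l, Module.Finite k (LefschetzBimodule.TorBimodule k A B C M N l) := hfin
    refine ⟨hfin', LefschetzBimodule.finite_setOf_nontrivial hD, ?_⟩
    ext r j
    refine (LefschetzBimodule.finsum_traceMatrix
      (T := LefschetzBimodule.TorBimodule k A B C M N) hD
      (LefschetzBimodule.torEnd φ ψ) r j).trans ?_
    simp only [LefschetzBimodule.traceMatrix_torEnd hf' hg', hsum,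
      LefschetzBimodule.weightedTrace_toRight_mul he' hf',
      LefschetzBimodule.trace_toLeft_mul hg' he', Matrix.mul_apply]
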